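/- Let $\mathbb S^1=\mathbb R/\mathbb Z$ and let $H^k=H^k(\mathbb S^1;\mathbb R^2)$ be the Sobolev space with norm $\|u\|_{H^k}^2=\sum_{j=0}^{k}\|\partial_x^j u\|_{L^2}^2$. For $\eta\in H^2\hookrightarrow C^1$ let $$|\eta|_*=\inf_{x\ne y}\frac{|\eta(x)-\eta(y)|}{d_{\mathbb S^1}(x,y)},\qquad d_{\mathbb S^1}(x,y)=\min_{k\in\mathbb Z}|x-y-k|,$$ and let $V=\{\eta\in H^2: |\eta|_*>0\}$. For $\eta\in V$ let $A(\eta)=\frac{1}{\pi|\partial_x\eta|^2}\,\partial_x^2$, viewed as an operator in $H^1$ with domain $H^3$. For $T>0$ let $$\mathbb E(0,T)=H^1(0,T;H^1)\cap L^2(0,T;H^3),\qquad \|\gamma\|_{\mathbb E(0,T)}^2=\|\gamma\|_{L^2(0,T;H^1)}^2+\|\partial_t\gamma\|_{L^2(0,T;H^1)}^2+\|\gamma\|_{L^2(0,T;H^3)}^2 .$$ Proposition 4.13. For every $\eta\in V$ the operator $A(\eta)$ has maximal $L^2$-regularity on $H^1$. More precisely, for every $T>0$ and every $g\in L^2(0,T;H^1)$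 there is a unique $\gamma\in\mathbb E(0,T)$ that solves $$\partial_t\gamma=A(\eta)\gamma+g\ \text{ in } \mathbb S^1\times(0,T),\qquad \gamma(0)=0,$$ where $\gamma(0)$ is the value at $0$ of the continuous representative of $\gamma$. Moreover, for every $\eta\in V$ and $T>0$ there is a constant $C>0$, independent of $g$, such that for all $g\in L^2(0,T;H^1)$ this solution satisfies $$\|\gamma\|_{\mathbb E(0,T)}\le C\|g\|_{L^2(0,T;H^1)} .$$ -/

import Mathlib

open MeasureTheory Set Filter Topology
open scoped ContDiff ENNReal

namespace ILLSS

noncomputable section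

/-- Integration of an `L²` function against a fixed scalar `L²` function is a continuous linear
map. -/
theorem exists_testPairing {α E : Type*} [MeasurableSpace α] {μ : Measure α}
    [NormedAddCommGroup E] [NormedSpace ℝ E] [CompleteSpace E]
    {φ : α → ℝ} (hφ : MemLp φ 2 μ) :
    ∃ L : Lp E 2 μ →L[ℝ] E, ∀ f : Lp E 2 μ, ∫ x, φ x • f x ∂μ = L f := by
  refine ⟨(ContinuousLinearMap.lsmul ℝ ℝ : ℝ →L[ℝ] E →L[ℝ] E).lpPairing μ 2 2 (hφ.toLp φ), ?_⟩
  intro f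
  rw [ContinuousLinearMap.lpPairing_eq_integral]
  refine integral_congr_ae ?_
  filter_upwards [hφ.coeFn_toLp] with x hx
  simp [hx]

/-! ### Sobolev spaces on the circle `S¹ = ℝ / ℤ` with values in the plane -/

/-- The Euclidean plane `ℝ²`. -/
abbrev Plane : Type := EuclideanSpace ℝ (Fin 2)

/-- `L²(S¹; ℝ²)`, where `S¹ = ℝ / ℤ` carries the Lebesgue measure (of total mass one). -/
abbrev L2 : Type := Lp Plane 2 (volume : Measure UnitAddCircle)

/-- Smooth real-valued functions on the circle. -/
def IsTest (φ : UnitAddCircle → ℝ) : Prop :=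
  ContDiff ℝ ∞ (fun s : ℝ => φ (s : UnitAddCircle))

/-- The derivative `∂ₓφ` of a function on the circle. -/
def circDeriv (φ : UnitAddCircle → ℝ) (x : UnitAddCircle) : ℝ :=
  deriv (fun s : ℝ => φ (x + (s : UnitAddCircle))) 0

/-- `g` is the weak derivative `∂ₓf` of `f` on the circle. -/
def IsWeakDeriv (f g : L2) : Prop :=
  ∀ φ : UnitAddCircle → ℝ, IsTest φ → ∫ x, circDeriv φ x • f x = -∫ x, φ x • g x

theorem IsTest.continuous {φ : UnitAddCircle → ℝ} (h : IsTest φ) : Continuous φ :=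
  continuous_coinduced_dom.2 (ContDiff.continuous h)

theorem circDeriv_coe (φ : UnitAddCircle → ℝ) (s : ℝ) :
    circDeriv φ (s : UnitAddCircle) = deriv (fun r : ℝ => φ (r : UnitAddCircle)) s := by
  have h := deriv_comp_const_add (fun r : ℝ => φ (r : UnitAddCircle)) s 0
  simpa [circDeriv, AddCircle.coe_add] using h

theorem IsTest.continuous_circDeriv {φ : UnitAddCircle → ℝ} (h : IsTest φ) :
    Continuous (circDeriv φ) := by
  refine continuous_coinduced_dom.2 ?_
  have : (circDeriv φ ∘ ((↑) : ℝ → UnitAddCircle)) =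
      deriv (fun r : ℝ => φ (r : UnitAddCircle)) := funext (circDeriv_coe φ)
  exact this ▸ ContDiff.continuous_deriv h (by simp)

theorem memLp_circle {φ : UnitAddCircle → ℝ} (h : Continuous φ) :
    MemLp φ 2 (volume : Measure UnitAddCircle) :=
  (h.memLp_of_hasCompactSupport (HasCompactSupport.of_compactSpace φ))

/-- The Sobolev space `Hᵏ(S¹; ℝ²)`: an element `u` is recorded as the tuple
`(u, ∂ₓu, …, ∂ₓᵏu)` of the function and its weak derivatives, all of them in `L²`. It is a
subspace of the Hilbert sum of `k + 1` copies of `L²`, so that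
`‖u‖² = ∑_{j ≤ k} ‖∂ₓʲu‖²_{L²}`. -/
def H (k : ℕ) : Submodule ℝ (PiLp 2 (fun _ : Fin (k + 1) => L2)) where
  carrier := {u | ∀ j : Fin k, IsWeakDeriv (u j.castSucc) (u j.succ)}
  zero_mem' := by
    intro j φ hφ
    obtain ⟨L, hL⟩ := exists_testPairing (E := Plane) (memLp_circle hφ.continuous)
    obtain ⟨M, hM⟩ := exists_testPairing (E := Plane) (memLp_circle hφ.continuous_circDeriv)
    rw [hL, hM]
    simp
  add_mem' := by
    intro u v hu hv j φ hφ
    obtain ⟨L, hL⟩ := exists_testPairing (E := Plane) (memLp_circle hφ.continuous)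
    obtain ⟨M, hM⟩ := exists_testPairing (E := Plane) (memLp_circle hφ.continuous_circDeriv)
    have h1 := hu j φ hφ
    have h2 := hv j φ hφ
    rw [hL, hM] at h1 h2 ⊢
    simp only [PiLp.add_apply, map_add, h1, h2]
    abel
  smul_mem' := by
    intro c u hu j φ hφ
    obtain ⟨L, hL⟩ := exists_testPairing (E := Plane) (memLp_circle hφ.continuous)
    obtain ⟨M, hM⟩ := exists_testPairing (E := Plane) (memLp_circle hφ.continuous_circDeriv)
    have h1 := hu j φ hφ
    rw [hL, hM] at h1 ⊢
    simp only [PiLp.smul_apply, map_smul, h1, smul_neg]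

theorem isClosed_H (k : ℕ) : IsClosed (H k : Set (PiLp 2 (fun _ : Fin (k + 1) => L2))) := by
  have hset : (H k : Set (PiLp 2 (fun _ : Fin (k + 1) => L2))) =
      ⋂ (j : Fin k) (φ : UnitAddCircle → ℝ) (_ : IsTest φ),
        {u | ∫ x, circDeriv φ x • u j.castSucc x = -∫ x, φ x • u j.succ x} := by
    ext u
    simp [H, IsWeakDeriv]
  rw [hset]
  refine isClosed_iInter fun j => isClosed_iInter fun φ => isClosed_iInter fun hφ => ?_
  obtain ⟨L, hL⟩ := exists_testPairing (E := Plane) (memLp_circle hφ.continuous)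
  obtain ⟨M, hM⟩ := exists_testPairing (E := Plane) (memLp_circle hφ.continuous_circDeriv)
  simp only [hL, hM]
  exact isClosed_eq (M.continuous.comp (PiLp.continuous_apply 2 _ _))
    (L.continuous.comp (PiLp.continuous_apply 2 _ _)).neg

instance instCompleteSpaceH (k : ℕ) : CompleteSpace (H k) :=
  (isClosed_H k).completeSpace_coe

/-- The weak derivative `∂ₓʲu ∈ L²` of `u ∈ Hᵏ`, for `j ≤ k`. -/
def der {k : ℕ} (u : H k) (j : Fin (k + 1)) : L2 :=
  (u : PiLp 2 (fun _ : Fin (k + 1) => L2)) j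

/-- `u ∈ Hᵏ` as an element of `L²`. -/
def toL2 {k : ℕ} (u : H k) : L2 := der u 0

/-! ### Admissible curves and the operator `A(η)` -/

/-- The chord-arc constant of a closed curve. The distance on `ℝ / ℤ` is the geodesic one,
`min_{k ∈ ℤ} |x - y - k|`. -/
def chordArc (c : UnitAddCircle → Plane) : ℝ :=
  ⨅ p : {p : UnitAddCircle × UnitAddCircle // p.1 ≠ p.2},
    ‖c p.1.1 - c p.1.2‖ / dist p.1.1 p.1.2

/-- The admissible set: the curves in `H²(S¹; ℝ²)` whose (unique) continuous representative has
positive chord-arc constant. -/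
def V : Set (H 2) :=
  {η | ∃ c : C(UnitAddCircle, Plane), (⇑c =ᵐ[volume] ⇑(toL2 η)) ∧ 0 < chordArc c}

/-- The differential operator `A(η) = (π |∂ₓη|²)⁻¹ ∂ₓ²` applied to `v ∈ H³`. -/
def A (η : H 2) (v : H 3) : UnitAddCircle → Plane :=
  fun x => (Real.pi * ‖der η 1 x‖ ^ 2)⁻¹ • der v 2 x

/-! ### Function spaces in time -/

/-- Lebesgue measure on the time interval `(0, T)`. -/
abbrev timeMeasure (T : ℝ) : Measure ℝ := volume.restrict (Ioo 0 T)

/-- The Bochner space `L²(0, T; X)`. -/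
abbrev TimeL2 (T : ℝ) (X : Type*) [NormedAddCommGroup X] : Type _ := Lp X 2 (timeMeasure T)

theorem memLp_time {T : ℝ} {φ : ℝ → ℝ} (h : Continuous φ) (hc : HasCompactSupport φ) :
    MemLp φ 2 (timeMeasure T) :=
  h.memLp_of_hasCompactSupport hc

/-- The space `H¹(0, T; X)`: an element `u` is recorded as the pair `(u, ∂ₜu)` of the function and
its weak derivative, with `‖u‖² = ‖u‖²_{L²(0,T;X)} + ‖∂ₜu‖²_{L²(0,T;X)}`. -/
def TimeH1 (T : ℝ) (X : Type*) [NormedAddCommGroup X] [NormedSpace ℝ X] [CompleteSpace X] :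
    Submodule ℝ (WithLp 2 (TimeL2 T X × TimeL2 T X)) where
  carrier := {p | ∀ φ : ℝ → ℝ, ContDiff ℝ ∞ φ → HasCompactSupport φ → tsupport φ ⊆ Ioo 0 T →
    ∫ t in Ioo 0 T, deriv φ t • p.fst t = -∫ t in Ioo 0 T, φ t • p.snd t}
  zero_mem' := by
    intro φ hφ hc _
    obtain ⟨L, hL⟩ := exists_testPairing (E := X) (memLp_time (T := T) hφ.continuous hc)
    obtain ⟨M, hM⟩ := exists_testPairing (E := X)
      (memLp_time (T := T) (hφ.continuous_deriv (by simp)) hc.deriv)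
    rw [hL, hM]
    simp
  add_mem' := by
    intro u v hu hv φ hφ hc hs
    obtain ⟨L, hL⟩ := exists_testPairing (E := X) (memLp_time (T := T) hφ.continuous hc)
    obtain ⟨M, hM⟩ := exists_testPairing (E := X)
      (memLp_time (T := T) (hφ.continuous_deriv (by simp)) hc.deriv)
    have h1 := hu φ hφ hc hs
    have h2 := hv φ hφ hc hs
    rw [hL, hM] at h1 h2 ⊢
    simp only [WithLp.add_fst, WithLp.add_snd, map_add, h1, h2]
    abel
  smul_mem' := by
    intro c u hu φ hφ hc hs
    obtain ⟨L, hL⟩ := exists_testPairing (E := X) (memLp_time (T := T) hφ.continuous hc)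
    obtain ⟨M, hM⟩ := exists_testPairing (E := X)
      (memLp_time (T := T) (hφ.continuous_deriv (by simp)) hc.deriv)
    have h1 := hu φ hφ hc hs
    rw [hL, hM] at h1 ⊢
    simp only [WithLp.smul_fst, WithLp.smul_snd, map_smul, h1, smul_neg]

/-- The maximal regularity space `E(0,T) = H¹(0,T;H¹) ∩ L²(0,T;H³)`: an element is recorded as the
pair of its two incarnations in `H¹(0,T;H¹)` and `L²(0,T;H³)`, which are the same function, and
`‖γ‖² = ‖γ‖²_{H¹(0,T;H¹)} + ‖γ‖²_{L²(0,T;H³)}`. -/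
def E (T : ℝ) : Submodule ℝ (WithLp 2 (TimeH1 T (H 1) × TimeL2 T (H 3))) where
  carrier := {p | ∀ᵐ t ∂timeMeasure T, toL2 (p.fst.1.fst t) = toL2 (p.snd t)}
  zero_mem' := by
    filter_upwards [Lp.coeFn_zero (H 1) 2 (timeMeasure T),
      Lp.coeFn_zero (H 3) 2 (timeMeasure T)] with t h1 h2
    change toL2 ((0 : Lp (H 1) 2 (timeMeasure T)) t) = toL2 ((0 : Lp (H 3) 2 (timeMeasure T)) t)
    rw [h1, h2]
    simp [toL2, der]
  add_mem' := by
    intro p q hp hq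
    filter_upwards [hp, hq, Lp.coeFn_add p.fst.1.fst q.fst.1.fst,
      Lp.coeFn_add p.snd q.snd] with t h1 h2 h3 h4
    simp only [WithLp.add_fst, WithLp.add_snd, Submodule.coe_add, h3, h4, Pi.add_apply]
    simp only [toL2, der] at h1 h2 ⊢
    simp [h1, h2]
  smul_mem' := by
    intro c p hp
    filter_upwards [hp, Lp.coeFn_smul c p.fst.1.fst, Lp.coeFn_smul c p.snd] with t h1 h3 h4
    simp only [WithLp.smul_fst, WithLp.smul_snd, Submodule.coe_smul, h3, h4, Pi.smul_apply]
    simp only [toL2, der] at h1 ⊢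
    simp [h1]

/-- `γ ∈ E(0,T)` as a curve in `H¹`. -/
def inH1 {T : ℝ} (γ : E T) : TimeL2 T (H 1) := γ.1.fst.1.fst

/-- The weak time derivative `∂ₜγ ∈ L²(0,T;H¹)` of `γ ∈ E(0,T)`. -/
def dt {T : ℝ} (γ : E T) : TimeL2 T (H 1) := γ.1.fst.1.snd

/-- `γ ∈ E(0,T)` as a curve in `H³`. -/
def inH3 {T : ℝ} (γ : E T) : TimeL2 T (H 3) := γ.1.snd

/-- `γ ∈ E(0,T)` solves `∂ₜγ = A(η)γ + g` in `S¹ × (0,T)`, `γ(0) = 0`, where `γ(0)` is the value at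
`0` of the (unique) representative of `γ` that is continuous on `[0,T]`. -/
def IsSolution {T : ℝ} (η : H 2) (g : TimeL2 T (H 1)) (γ : E T) : Prop :=
  (∀ᵐ t ∂timeMeasure T, ∀ᵐ x : UnitAddCircle,
    toL2 (dt γ t) x = A η (inH3 γ t) x + toL2 (g t) x) ∧
  ∃ c : ℝ → H 1, ContinuousOn c (Icc 0 T) ∧ c =ᵐ[timeMeasure T] inH1 γ ∧ c 0 = 0

end

end ILLSS

/-! Put `m = π|∂ₓη|²`. The chord-arc condition bounds `|∂ₓη|` from below, and `η ∈ H²` makes `m` a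
bounded `H¹` function, so `A(η) = m⁻¹∂ₓ²` has a positive weight on which multiplication by `m`
preserves `H¹`. On `H¹` let `M` and `D` represent the forms `∫ m u·φ` and `∫ ∂ₓu·∂ₓφ`. Their sum `G
= M + D` is coercive, hence an equivalent inner product, and `1 - A(η)` is symmetric for it with
inverse `R = G⁻¹M`. Since `∂ₓ²(R f) = m (R f - f)` lies in `H¹`, `R` maps `H¹` boundedly into `H³`
(`exists_spatial_resolvent`).

A function with `γ(0) = 0` is the Volterra integral `γ = J p` of `p = ∂ₜγ`, and the equation becomes
`J p = R (J p + g - p)` in `L²(0,T;H¹)` (`isSolution_iff`). No semigroup is needed: `R` acts in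
space and `J` in time, so they commute, and the ansatz `p = R h`, `-A(η)γ = J (h - R h)` turns the
equation into `S h = g` with `S = R + J (1 - R)`. When `⟪G S h, S h⟫` is expanded, the cross term
equals `2 ∫ ⟪B h, J h⟫ dt` for a symmetric positive semidefinite `B`, that is, `⟪B H, H⟫` at time
`T` with `H = J h`, hence nonnegative. Therefore `‖R h‖ ≤ K ‖S h‖`, which is the maximal regularity
estimate; a similar sign argument shows that `S` has dense range (`existsUnique_sum_of_commuting`,
`existsUnique_evolution`). Existence follows by approximating `g`, and the `H³` bound by applying
the regularized resolvent. -/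

namespace ILLSS

noncomputable section

/-! ### Vector-valued primitives and weak derivatives on an interval. -/

section Primitive

variable {E F G : Type*} [NormedAddCommGroup E] [NormedSpace ℝ E] [CompleteSpace E]
  [NormedAddCommGroup F] [NormedSpace ℝ F] [CompleteSpace F]
  [NormedAddCommGroup G] [NormedSpace ℝ G] [CompleteSpace G]

omit [CompleteSpace E] [CompleteSpace F] [CompleteSpace G] in
theorem integrable_bilin_prod {α β : Type*} [MeasurableSpace α] [MeasurableSpace β]
    {μ : Measure α} {ν : Measure β} [SFinite μ] [SFinite ν] (B : E →L[ℝ] F →L[ℝ] G) {g : α → E}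
    {k : β → F} (hg : Integrable g μ) (hk : Integrable k ν) :
    Integrable (fun z : α × β => B (g z.1) (k z.2)) (μ.prod ν) := by
  refine Integrable.mono' (g := fun z : α × β => ‖B‖ * (‖g z.1‖ * ‖k z.2‖))
    ((hg.norm.mul_prod hk.norm).const_mul _) ?_ ?_
  · exact B.aestronglyMeasurable_comp₂ hg.aestronglyMeasurable.comp_fst
      hk.aestronglyMeasurable.comp_snd
  · refine Eventually.of_forall fun z => ?_
    rw [← mul_assoc]
    exact B.le_opNorm₂ _ _

/-- Fubini on the square `(0,s]²`: the two terms integrate `B (g t) (k r)` over the two sides of the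
diagonal. This yields the product rule for functions that are merely primitives of integrable ones.
-/
theorem integral_bilin_primitive_zero (B : E →L[ℝ] F →L[ℝ] G) {s : ℝ} (hs : 0 ≤ s) {g : ℝ → E}
    {k : ℝ → F} (hg : IntegrableOn g (Ioc 0 s)) (hk : IntegrableOn k (Ioc 0 s)) :
    (∫ t in 0..s, B (g t) (∫ r in 0..t, k r)) + ∫ t in 0..s, B (∫ r in 0..t, g r) (k t) =
      B (∫ t in 0..s, g t) (∫ t in 0..s, k t) := by
  set μ : Measure ℝ := volume.restrict (Ioc 0 s) with hμ
  have hint := integrable_bilin_prod B (μ := μ) (ν := μ) hg hk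
  set D : Set (ℝ × ℝ) := {z | z.2 ≤ z.1} with hD
  have hDm : MeasurableSet D := measurableSet_le measurable_snd measurable_fst
  have h1 : ∫ t in 0..s, B (g t) (∫ r in 0..t, k r) =
      ∫ z in D, B (g z.1) (k z.2) ∂(μ.prod μ) := by
    rw [← integral_indicator hDm, integral_prod _ (hint.indicator hDm),
      intervalIntegral.integral_of_le hs]
    refine setIntegral_congr_fun measurableSet_Ioc fun t ht => ?_
    have : (fun r => D.indicator (fun z : ℝ × ℝ => B (g z.1) (k z.2)) (t, r)) =
        (Iic t).indicator (fun r => B (g t) (k r)) := by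
      ext r; simp [D, indicator]
    simp only [this]
    rw [integral_indicator measurableSet_Iic, hμ, Measure.restrict_restrict measurableSet_Iic,
      intervalIntegral.integral_of_le ht.1.le]
    have hset : Iic t ∩ Ioc 0 s = Ioc 0 t := by
      ext r; simp only [mem_inter_iff, mem_Iic, mem_Ioc]
      exact ⟨fun h => ⟨h.2.1, h.1⟩, fun h => ⟨h.2, h.1, h.2.trans ht.2⟩⟩
    rw [hset]
    exact ((B (g t)).integral_comp_comm (hk.mono_set (Ioc_subset_Ioc_right ht.2))).symm
  have h2 : ∫ t in 0..s, B (∫ r in 0..t, g r) (k t) =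
      ∫ z in Dᶜ, B (g z.1) (k z.2) ∂(μ.prod μ) := by
    rw [← integral_indicator hDm.compl, integral_prod_symm _ (hint.indicator hDm.compl),
      intervalIntegral.integral_of_le hs]
    refine setIntegral_congr_fun measurableSet_Ioc fun t ht => ?_
    have : (fun r => Dᶜ.indicator (fun z : ℝ × ℝ => B (g z.1) (k z.2)) (r, t)) =
        (Iio t).indicator (fun r => B (g r) (k t)) := by
      ext r; simp [D, indicator]
    simp only [this]
    rw [integral_indicator measurableSet_Iio, hμ, Measure.restrict_restrict measurableSet_Iio,
      intervalIntegral.integral_of_le ht.1.le, integral_Ioc_eq_integral_Ioo]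
    have hset : Iio t ∩ Ioc 0 s = Ioo 0 t := by
      ext r; simp only [mem_inter_iff, mem_Iio, mem_Ioc, mem_Ioo]
      exact ⟨fun h => ⟨h.2.1, h.1⟩, fun h => ⟨h.2, h.1, (h.2.trans_le ht.2).le⟩⟩
    rw [hset]
    exact ((B.flip (k t)).integral_comp_comm
      (hg.mono_set (Ioo_subset_Ioc_self.trans (Ioc_subset_Ioc_right ht.2)))).symm
  rw [h1, h2, integral_add_compl hDm hint, integral_prod _ hint,
    intervalIntegral.integral_of_le hs, intervalIntegral.integral_of_le hs]
  have h3 : ∀ t, ∫ r, B (g t) (k r) ∂μ = B.flip (∫ r, k r ∂μ) (g t) := fun t =>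
    (B (g t)).integral_comp_comm hk
  simp only [h3]
  exact (B.flip (∫ r, k r ∂μ)).integral_comp_comm hg

omit [CompleteSpace E] in
theorem continuousOn_primitive {s : ℝ} (hs : 0 ≤ s) {g : ℝ → E} (hg : IntegrableOn g (Ioc 0 s)) :
    ContinuousOn (fun t => ∫ r in 0..t, g r) (Icc 0 s) := by
  have := intervalIntegral.continuousOn_primitive_interval (μ := volume) (a := 0) (b := s) (f := g)
    (by rw [uIcc_of_le hs]; exact (integrableOn_Icc_iff_integrableOn_Ioc).2 hg)
  rwa [uIcc_of_le hs] at this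

omit [CompleteSpace E] [CompleteSpace F] [CompleteSpace G] in
theorem integrableOn_bilin_left (B : E →L[ℝ] F →L[ℝ] G) {s : ℝ} {g : ℝ → E} {k : ℝ → F}
    (hg : IntegrableOn g (Ioc 0 s)) (hk : ContinuousOn k (Icc 0 s)) :
    IntegrableOn (fun t => B (g t) (k t)) (Ioc 0 s) := by
  obtain ⟨C, hC⟩ := isCompact_Icc.exists_bound_of_continuousOn hk
  refine Integrable.mono' (g := fun t => ‖B‖ * C * ‖g t‖) (hg.norm.const_mul _) ?_ ?_
  · exact B.aestronglyMeasurable_comp₂ hg.aestronglyMeasurable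
      ((hk.mono Ioc_subset_Icc_self).aestronglyMeasurable measurableSet_Ioc)
  · filter_upwards [ae_restrict_mem measurableSet_Ioc] with t ht
    refine (B.le_opNorm₂ _ _).trans ?_
    have := hC t (Ioc_subset_Icc_self ht)
    rw [mul_right_comm]
    gcongr

theorem integral_bilin_primitive (B : E →L[ℝ] F →L[ℝ] G) {s : ℝ} (hs : 0 ≤ s) (a : E) (b : F)
    {g : ℝ → E} {k : ℝ → F} (hg : IntegrableOn g (Ioc 0 s)) (hk : IntegrableOn k (Ioc 0 s)) :
    (∫ t in 0..s, (B (g t) (b + ∫ r in 0..t, k r) + B (a + ∫ r in 0..t, g r) (k t))) =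
      B (a + ∫ t in 0..s, g t) (b + ∫ t in 0..s, k t) - B a b := by
  have hgi : IntervalIntegrable g volume 0 s := (intervalIntegrable_iff_integrableOn_Ioc_of_le hs).2 hg
  have hki : IntervalIntegrable k volume 0 s := (intervalIntegrable_iff_integrableOn_Ioc_of_le hs).2 hk
  have i1 : IntervalIntegrable (fun t => B (g t) (∫ r in 0..t, k r)) volume 0 s :=
    (intervalIntegrable_iff_integrableOn_Ioc_of_le hs).2
      (integrableOn_bilin_left B hg (continuousOn_primitive hs hk))
  have i2 : IntervalIntegrable (fun t => B (∫ r in 0..t, g r) (k t)) volume 0 s :=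
    (intervalIntegrable_iff_integrableOn_Ioc_of_le hs).2
      (integrableOn_bilin_left B.flip hk (continuousOn_primitive hs hg))
  have i3 : IntervalIntegrable (fun t => B (g t) b) volume 0 s :=
    ⟨(B.flip b).integrable_comp hgi.1, (B.flip b).integrable_comp hgi.2⟩
  have i4 : IntervalIntegrable (fun t => B a (k t)) volume 0 s :=
    ⟨(B a).integrable_comp hki.1, (B a).integrable_comp hki.2⟩
  have e3 : ∫ t in 0..s, B (g t) b = B (∫ t in 0..s, g t) b :=
    (B.flip b).intervalIntegral_comp_comm hgi
  have e4 : ∫ t in 0..s, B a (k t) = B a (∫ t in 0..s, k t) :=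
    (B a).intervalIntegral_comp_comm hki
  have e := integral_bilin_primitive_zero B hs hg hk
  simp only [map_add, add_apply]
  rw [intervalIntegral.integral_add (i3.add i1) (i4.add i2), intervalIntegral.integral_add i3 i1,
    intervalIntegral.integral_add i4 i2, e3, e4, ← e]
  abel

/-- A function on `(0,T)` with weak derivative zero is almost everywhere constant. -/
theorem ae_eq_const_of_weakDeriv_zero {T : ℝ} (hT : 0 < T) {f : ℝ → E}
    (hf : IntegrableOn f (Ioo 0 T))
    (h : ∀ φ : ℝ → ℝ, ContDiff ℝ ∞ φ → HasCompactSupport φ → tsupport φ ⊆ Ioo 0 T →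
      ∫ t in Ioo 0 T, deriv φ t • f t = 0) :
    ∃ c : E, ∀ᵐ t ∂volume.restrict (Ioo 0 T), f t = c := by
  -- A bump of mass one supported in `[T/4, 3T/4]`; the constant will be the `ρ`-average of `f`.
  let ρb : ContDiffBump (T / 2) := ⟨T / 8, T / 4, by linarith, by linarith⟩
  set ρ : ℝ → ℝ := ρb.normed volume with hρ
  have hρs : ContDiff ℝ ∞ ρ := ρb.contDiff_normed
  have hρc : HasCompactSupport ρ := ρb.hasCompactSupport_normed
  have hρt : tsupport ρ ⊆ Ioo 0 T := by
    rw [hρ, ρb.tsupport_normed_eq, Real.closedBall_eq_Icc]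
    intro x hx
    simp only [ρb, mem_Icc] at hx
    exact ⟨by linarith [hx.1], by linarith [hx.2]⟩
  have hρi : ∫ x, ρ x = 1 := ρb.integral_normed
  set c : E := ∫ t in Ioo 0 T, ρ t • f t with hc
  refine ⟨c, ?_⟩
  have key : ∀ ψ : ℝ → ℝ, ContDiff ℝ ∞ ψ → HasCompactSupport ψ → tsupport ψ ⊆ Ioo 0 T →
      ∫ t, ψ t • ((Ioo 0 T).indicator (fun t => f t - c) t) = 0 := by
    intro ψ hψ hψc hψt
    set m := ∫ x, ψ x with hm
    -- Subtracting `m ρ` makes the mean zero, so the primitive of `χ` is again compactly supported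
    -- in `(0,T)` and is an admissible test function.
    let χ : ℝ → ℝ := fun x => ψ x - m * ρ x
    have hχs : ContDiff ℝ ∞ χ := hψ.sub (contDiff_const.mul hρs)
    set K : Set ℝ := tsupport ψ ∪ tsupport ρ with hK
    have hKc : IsCompact K := hψc.isCompact.union hρc.isCompact
    have hKT : K ⊆ Ioo 0 T := union_subset hψt hρt
    have hχ0 : ∀ x, x ∉ K → χ x = 0 := by
      intro x hx
      simp only [hK, mem_union, not_or] at hx
      simp [χ, image_eq_zero_of_notMem_tsupport hx.1, image_eq_zero_of_notMem_tsupport hx.2]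
    obtain ⟨a, b, ha, hb, hKab⟩ : ∃ a b, 0 < a ∧ b < T ∧ K ⊆ Icc a b := by
      have hne : K.Nonempty := by
        by_contra hne
        rw [not_nonempty_iff_eq_empty] at hne
        have : ρ = 0 := by
          have h0 : tsupport ρ = ∅ := by
            apply subset_empty_iff.1; rw [← hne]; exact subset_union_right
          exact tsupport_eq_empty_iff.1 h0
        simp [this] at hρi
      obtain ⟨a, ha⟩ := hKc.exists_isLeast hne
      obtain ⟨b, hb⟩ := hKc.exists_isGreatest hne
      exact ⟨a, b, (hKT ha.1).1, (hKT hb.1).2, fun x hx => ⟨ha.2 hx, hb.2 hx⟩⟩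
    let φ : ℝ → ℝ := fun x => ∫ t in 0..x, χ t
    have hφd : ∀ x, HasDerivAt φ (χ x) x := fun x =>
      intervalIntegral.integral_hasDerivAt_right (hχs.continuous.intervalIntegrable _ _)
        (hχs.continuous.stronglyMeasurableAtFilter _ _) hχs.continuous.continuousAt
    have hφ' : deriv φ = χ := funext fun x => (hφd x).deriv
    have hφs : ContDiff ℝ ∞ φ := by
      rw [contDiff_infty_iff_deriv]
      exact ⟨fun x => (hφd x).differentiableAt, hφ' ▸ hχs⟩
    have hψi : Integrable ψ := hψ.continuous.integrable_of_hasCompactSupport hψc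
    have hρi' : Integrable ρ := hρs.continuous.integrable_of_hasCompactSupport hρc
    have hχi : ∫ x, χ x = 0 := by
      simp only [χ]
      rw [integral_sub hψi (hρi'.const_mul _), integral_const_mul, hρi, mul_one, sub_self]
    have hφ0 : ∀ x, x ∉ Icc a b → φ x = 0 := by
      intro x hx
      by_cases hxa : x < a
      · refine (intervalIntegral.integral_congr (g := fun _ => (0 : ℝ)) fun t ht => ?_).trans
          (by simp)
        refine hχ0 t fun htK => ?_
        have h1 := (hKab htK).1
        rcases mem_uIcc.1 ht with h2 | h2 <;> linarith [h2.1, h2.2]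
      · have hxb : b < x := by
          by_contra hxb
          exact hx ⟨not_lt.1 hxa, not_lt.1 hxb⟩
        by_cases hab : a ≤ b
        · have : φ x = ∫ t, χ t := by
            simp only [φ]
            rw [intervalIntegral.integral_of_le (by linarith)]
            refine setIntegral_eq_integral_of_forall_compl_eq_zero fun t ht => hχ0 t fun htK => ?_
            exact ht ⟨by linarith [(hKab htK).1], by linarith [(hKab htK).2]⟩
          rw [this, hχi]
        · refine (intervalIntegral.integral_congr (g := fun _ => (0 : ℝ)) fun t ht => ?_).trans
            (by simp)
          refine hχ0 t fun htK => ?_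
          have h1 := hKab htK
          exact hab (h1.1.trans h1.2)
    have hφt : tsupport φ ⊆ Icc a b :=
      closure_minimal (fun x hx => by by_contra hx'; exact hx (hφ0 x hx')) isClosed_Icc
    have h0 := h φ hφs (HasCompactSupport.of_support_subset_isCompact isCompact_Icc
      ((subset_tsupport φ).trans hφt)) (hφt.trans fun x hx => ⟨by linarith [hx.1], by linarith [hx.2]⟩)
    rw [hφ'] at h0
    have iψ : IntegrableOn (fun t => ψ t • f t) (Ioo 0 T) := by
      obtain ⟨C, hC⟩ := hψc.exists_bound_of_continuous hψ.continuous
      exact hf.bdd_smul C hψ.continuous.aestronglyMeasurable (Eventually.of_forall hC)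
    have iρ : IntegrableOn (fun t => ρ t • f t) (Ioo 0 T) := by
      obtain ⟨C, hC⟩ := hρc.exists_bound_of_continuous hρs.continuous
      exact hf.bdd_smul C hρs.continuous.aestronglyMeasurable (Eventually.of_forall hC)
    have iρm : IntegrableOn (fun t => m • ρ t • f t) (Ioo 0 T) := iρ.smul m
    have h1 : ∫ t in Ioo 0 T, χ t • f t = (∫ t in Ioo 0 T, ψ t • f t) - m • c := by
      simp only [χ, sub_smul, mul_smul]
      rw [integral_sub iψ iρm, integral_smul]
    have hmr : ∫ t in Ioo 0 T, ψ t = m :=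
      setIntegral_eq_integral_of_forall_compl_eq_zero fun t ht =>
        image_eq_zero_of_notMem_tsupport fun ht' => ht (hψt ht')
    have h2 : ∀ t, ψ t • ((Ioo 0 T).indicator (fun t => f t - c) t) =
        (Ioo 0 T).indicator (fun t => ψ t • f t - ψ t • c) t := by
      intro t
      by_cases ht : t ∈ Ioo 0 T <;> simp [ht, smul_sub]
    simp only [h2]
    rw [integral_indicator measurableSet_Ioo, integral_sub iψ (hψi.integrableOn.smul_const c),
      integral_smul_const, hmr, ← h1, h0]
  have hloc : LocallyIntegrableOn ((Ioo 0 T).indicator (fun t => f t - c)) (Ioo 0 T) := by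
    refine LocallyIntegrable.locallyIntegrableOn (Integrable.locallyIntegrable ?_) _
    rw [integrable_indicator_iff measurableSet_Ioo]
    exact hf.sub (integrableOn_const (by simp))
  have := isOpen_Ioo.ae_eq_zero_of_integral_contDiff_smul_eq_zero hloc key
  rw [ae_restrict_iff' measurableSet_Ioo]
  filter_upwards [this] with t ht htT
  have h3 := ht htT
  rw [indicator_of_mem htT, sub_eq_zero] at h3
  exact h3

/-- A primitive satisfies the integration by parts formula. -/
theorem integral_deriv_smul_primitive {T : ℝ} (hT : 0 ≤ T) (c : E) {g : ℝ → E}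
    (hg : IntegrableOn g (Ioc 0 T)) {φ : ℝ → ℝ} (hφ : ContDiff ℝ ∞ φ) :
    (∫ t in 0..T, deriv φ t • (c + ∫ r in 0..t, g r)) =
      φ T • (c + ∫ r in 0..T, g r) - φ 0 • c - ∫ t in 0..T, φ t • g t := by
  have hφc : Continuous (deriv φ) := hφ.continuous_deriv (by simp)
  have hφi : ∀ t, φ 0 + ∫ r in 0..t, deriv φ r = φ t := by
    intro t
    rw [intervalIntegral.integral_deriv_eq_sub (fun x _ => hφ.differentiable (by simp) x)
      (hφc.intervalIntegrable _ _)]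
    abel
  have hdi : IntegrableOn (deriv φ) (Ioc 0 T) := hφc.integrableOn_Ioc
  have := integral_bilin_primitive (ContinuousLinearMap.lsmul ℝ ℝ : ℝ →L[ℝ] E →L[ℝ] E) hT (φ 0) c
    hdi hg
  simp only [hφi, ContinuousLinearMap.lsmul_apply] at this
  rw [intervalIntegral.integral_add] at this
  · rw [← this]; abel
  · exact (intervalIntegrable_iff_integrableOn_Ioc_of_le hT).2
      (integrableOn_bilin_left (ContinuousLinearMap.lsmul ℝ ℝ : ℝ →L[ℝ] E →L[ℝ] E) hdi
        (continuousOn_const.add (continuousOn_primitive hT hg)))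
  · exact (intervalIntegrable_iff_integrableOn_Ioc_of_le hT).2
      (integrableOn_bilin_left (ContinuousLinearMap.lsmul ℝ ℝ : ℝ →L[ℝ] E →L[ℝ] E).flip hg
        hφ.continuous.continuousOn)

/-- A function with integrable weak derivative on `(0,T)` is a primitive of it. -/
theorem ae_eq_primitive_of_weakDeriv {T : ℝ} (hT : 0 < T) {f g : ℝ → E}
    (hf : IntegrableOn f (Ioo 0 T)) (hg : IntegrableOn g (Ioo 0 T))
    (h : ∀ φ : ℝ → ℝ, ContDiff ℝ ∞ φ → HasCompactSupport φ → tsupport φ ⊆ Ioo 0 T →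
      ∫ t in Ioo 0 T, deriv φ t • f t = -∫ t in Ioo 0 T, φ t • g t) :
    ∃ c : E, ∀ᵐ t ∂volume.restrict (Ioo 0 T), f t = c + ∫ r in 0..t, g r := by
  have hg' : IntegrableOn g (Ioc 0 T) := (integrableOn_Ioc_iff_integrableOn_Ioo (by simp)).2 hg
  have hcont := continuousOn_primitive hT.le hg'
  have hFi : IntegrableOn (fun t => ∫ r in 0..t, g r) (Ioo 0 T) :=
    (hcont.integrableOn_Icc).mono_set Ioo_subset_Icc_self
  obtain ⟨c, hc⟩ := ae_eq_const_of_weakDeriv_zero hT (hf.sub hFi) (fun φ hφ hφc hφt => by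
    have hφ0 : φ 0 = 0 := image_eq_zero_of_notMem_tsupport fun h' => lt_irrefl _ (hφt h').1
    have hφT : φ T = 0 := image_eq_zero_of_notMem_tsupport fun h' => lt_irrefl _ (hφt h').2
    have h1 := integral_deriv_smul_primitive hT.le 0 hg' hφ
    simp only [intervalIntegral.integral_of_le hT.le, integral_Ioc_eq_integral_Ioo, hφ0, hφT,
      zero_smul, zero_add, sub_zero, zero_sub] at h1
    have hd : Continuous (deriv φ) := hφ.continuous_deriv (by simp)
    obtain ⟨C, hC⟩ := hφc.deriv.exists_bound_of_continuous hd
    simp only [Pi.sub_apply, smul_sub]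
    have i1 : IntegrableOn (fun t => deriv φ t • f t) (Ioo 0 T) :=
      hf.bdd_smul C hd.aestronglyMeasurable (Eventually.of_forall hC)
    have i2 : IntegrableOn (fun t => deriv φ t • ∫ r in 0..t, g r) (Ioo 0 T) :=
      hFi.bdd_smul C hd.aestronglyMeasurable (Eventually.of_forall hC)
    rw [integral_sub i1 i2, h φ hφ hφc hφt]
    rw [h1, sub_self])
  refine ⟨c, ?_⟩
  filter_upwards [hc] with t ht
  rw [← ht]
  simp

end Primitive

/-! ### Absolutely continuous functions on the circle and the speed of a chord-arc curve. -/

section Circle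

variable {E F G : Type*} [NormedAddCommGroup E] [NormedSpace ℝ E] [CompleteSpace E]
  [NormedAddCommGroup F] [NormedSpace ℝ F] [CompleteSpace F]
  [NormedAddCommGroup G] [NormedSpace ℝ G] [CompleteSpace G]

theorem measurePreserving_coe_circle :
    MeasurePreserving ((↑) : ℝ → UnitAddCircle) (volume.restrict (Ioc 0 1)) volume := by
  have := UnitAddCircle.measurePreserving_mk 0
  rwa [zero_add] at this

omit [CompleteSpace E] in
theorem integral_circle (f : UnitAddCircle → E) :
    ∫ x, f x = ∫ s in Ioc (0 : ℝ) 1, f (s : UnitAddCircle) := by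
  have := UnitAddCircle.integral_preimage 0 f
  rw [zero_add] at this
  exact this.symm

theorem ae_circle_iff {P : UnitAddCircle → Prop} :
    (∀ᵐ x, P x) ↔ ∀ᵐ s : ℝ ∂volume.restrict (Ioc 0 1), P (s : UnitAddCircle) := by
  refine ⟨fun h => measurePreserving_coe_circle.quasiMeasurePreserving.ae h, fun h => ?_⟩
  have h1 := (measurePreserving_subtype_coe (μa := (volume : Measure ℝ))
    (measurableSet_Ioc (a := (0 : ℝ)) (b := 0 + 1))).comp
    (AddCircle.measurePreserving_equivIoc 1 (a := 0))
  have hset : Ioc (0 : ℝ) 1 = Ioc 0 (0 + 1) := by rw [zero_add]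
  rw [hset] at h
  filter_upwards [h1.quasiMeasurePreserving.ae h] with x hx
  have : ((AddCircle.equivIoc (1 : ℝ) 0 x : ℝ) : UnitAddCircle) = x :=
    (AddCircle.equivIoc (1 : ℝ) 0).symm_apply_apply x
  simpa [this] using hx

/-- `f` agrees almost everywhere on the circle with an absolutely continuous function whose
derivative is `g`. -/
def IsAbsCont (f g : UnitAddCircle → E) : Prop :=
  IntegrableOn (fun s : ℝ => g s) (Ioc 0 1) ∧ ∫ r in (0 : ℝ)..1, g r = 0 ∧
    ∃ c : E, ∀ᵐ s : ℝ ∂volume.restrict (Ioc 0 1), f s = c + ∫ r in (0 : ℝ)..s, g r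

omit [CompleteSpace E] in
theorem IsAbsCont.integral_eq_zero {f g : UnitAddCircle → E} (h : IsAbsCont f g) :
    ∫ x, g x = 0 := by
  rw [integral_circle, ← intervalIntegral.integral_of_le zero_le_one, h.2.1]

theorem IsAbsCont.bilin (B : E →L[ℝ] F →L[ℝ] G) {f g : UnitAddCircle → E}
    {h k : UnitAddCircle → F} (hf : IsAbsCont f g) (hh : IsAbsCont h k) :
    IsAbsCont (fun x => B (f x) (h x)) (fun x => B (g x) (h x) + B (f x) (k x)) := by
  obtain ⟨hg, hg0, a, ha⟩ := hf
  obtain ⟨hk, hk0, b, hb⟩ := hh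
  have e : ∀ᵐ s : ℝ ∂volume.restrict (Ioc 0 1), B (g s) (h s) + B (f s) (k s) =
      B (g s) (b + ∫ r in (0 : ℝ)..s, k r) + B (a + ∫ r in (0 : ℝ)..s, g r) (k s) := by
    filter_upwards [ha, hb] with s h1 h2
    rw [h1, h2]
  have hint : IntegrableOn (fun s : ℝ => B (g s) (b + ∫ r in (0 : ℝ)..s, k r) +
      B (a + ∫ r in (0 : ℝ)..s, g r) (k s)) (Ioc 0 1) :=
    (integrableOn_bilin_left B hg
      (continuousOn_const.add (continuousOn_primitive zero_le_one hk))).add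
    (integrableOn_bilin_left B.flip hk
      (continuousOn_const.add (continuousOn_primitive zero_le_one hg)))
  have hs : ∀ s : ℝ, s ∈ Icc (0 : ℝ) 1 → ∫ r in (0 : ℝ)..s, (B (g r) (h r) + B (f r) (k r)) =
      B (a + ∫ r in (0 : ℝ)..s, g r) (b + ∫ r in (0 : ℝ)..s, k r) - B a b := by
    intro s hs
    rw [← integral_bilin_primitive B hs.1 a b (hg.mono_set (Ioc_subset_Ioc_right hs.2))
      (hk.mono_set (Ioc_subset_Ioc_right hs.2)), intervalIntegral.integral_of_le hs.1,
      intervalIntegral.integral_of_le hs.1]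
    exact integral_congr_ae (ae_restrict_of_ae_restrict_of_subset (Ioc_subset_Ioc_right hs.2) e)
  refine ⟨hint.congr_fun_ae (e.mono fun s hs => hs.symm), ?_, B a b, ?_⟩
  · rw [hs 1 (by simp), hg0, hk0]
    simp
  · filter_upwards [ha, hb, ae_restrict_mem measurableSet_Ioc] with s h1 h2 h3
    rw [hs s (Ioc_subset_Icc_self h3), h1, h2]
    abel

theorem IsAbsCont.integral_parts (B : E →L[ℝ] F →L[ℝ] G) {f g : UnitAddCircle → E}
    {h k : UnitAddCircle → F} (hf : IsAbsCont f g) (hh : IsAbsCont h k) :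
    ∫ x, (B (g x) (h x) + B (f x) (k x)) = 0 :=
  (hf.bilin B hh).integral_eq_zero

-- The one-dimensional Sobolev embedding: the constant `c` is bounded by averaging `‖c‖ ≤ ‖f s‖ +
-- ∫‖g‖` over the circle, which has mass one, and the primitive adds a second `∫‖g‖`.
omit [CompleteSpace E] in
theorem IsAbsCont.norm_le {f g : UnitAddCircle → E} (hf : IsAbsCont f g) :
    ∀ᵐ x, ‖f x‖ ≤ (∫ x, ‖f x‖) + 2 * ∫ x, ‖g x‖ := by
  obtain ⟨hg, -, c, hc⟩ := hf
  rw [ae_circle_iff, integral_circle, integral_circle]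
  set N := ∫ s in Ioc (0 : ℝ) 1, ‖g s‖ with hN
  have hb : ∀ s ∈ Ioc (0 : ℝ) 1, ‖∫ r in (0 : ℝ)..s, g r‖ ≤ N := by
    intro s hs
    refine (intervalIntegral.norm_integral_le_integral_norm hs.1.le).trans ?_
    rw [intervalIntegral.integral_of_le hs.1.le]
    exact setIntegral_mono_set hg.norm (Eventually.of_forall fun _ => norm_nonneg _)
      (Ioc_subset_Ioc_right hs.2).eventuallyLE
  have hfi : IntegrableOn (fun s : ℝ => f s) (Ioc 0 1) := by
    have : IntegrableOn (fun s : ℝ => c + ∫ r in (0 : ℝ)..s, g r) (Ioc 0 1) :=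
      ((continuousOn_const.add (continuousOn_primitive zero_le_one hg)).integrableOn_Icc).mono_set
        Ioc_subset_Icc_self
    exact this.congr_fun_ae (hc.mono fun s hs => hs.symm)
  have hcb : ‖c‖ ≤ (∫ s in Ioc (0 : ℝ) 1, ‖f s‖) + N := by
    have h1 : ∫ _ in Ioc (0 : ℝ) 1, ‖c‖ ≤ ∫ s in Ioc (0 : ℝ) 1, (‖f s‖ + N) := by
      refine integral_mono_ae (integrable_const _) (hfi.norm.add (integrable_const _)) ?_
      filter_upwards [hc, ae_restrict_mem measurableSet_Ioc] with s h1 h2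
      have h3 := hb s h2
      have h4 : c = f s - ∫ r in (0 : ℝ)..s, g r := by rw [h1]; abel
      calc ‖c‖ = ‖f s - ∫ r in (0 : ℝ)..s, g r‖ := by rw [← h4]
        _ ≤ ‖f s‖ + ‖∫ r in (0 : ℝ)..s, g r‖ := norm_sub_le _ _
        _ ≤ ‖f s‖ + N := by gcongr
    rw [integral_add hfi.norm (integrable_const _)] at h1
    simpa using h1
  filter_upwards [hc, ae_restrict_mem measurableSet_Ioc] with s h1 h2
  have h3 := hb s h2
  rw [h1]
  calc ‖c + ∫ r in (0 : ℝ)..s, g r‖ ≤ ‖c‖ + ‖∫ r in (0 : ℝ)..s, g r‖ := norm_add_le _ _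
    _ ≤ _ := by linarith

/-- A smooth function compactly supported in `(0,1)` extends periodically to the circle. -/
theorem exists_isTest_extension {φ : ℝ → ℝ} (hφ : ContDiff ℝ ∞ φ) (hs : tsupport φ ⊆ Ioo 0 1) :
    ∃ ψ : UnitAddCircle → ℝ, IsTest ψ ∧ (∀ s ∈ Ioo (0 : ℝ) 1, ψ s = φ s) ∧
      ∀ s ∈ Ioo (0 : ℝ) 1, circDeriv ψ s = deriv φ s := by
  set ψ : UnitAddCircle → ℝ := AddCircle.liftIoc 1 0 φ with hψ
  have h0 : ∀ t : ℝ, t ∉ Ioo (0 : ℝ) 1 → φ t = 0 := fun t ht =>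
    image_eq_zero_of_notMem_tsupport fun h => ht (hs h)
  have h1 : ∀ t ∈ Ioc (0 : ℝ) 1, ψ t = φ t := fun t ht =>
    AddCircle.liftIoc_coe_apply (by simpa using ht)
  have hper : ∀ (t : ℝ) (n : ℤ), ψ ((t - n : ℝ) : UnitAddCircle) = ψ t := by
    intro t n
    congr 1
    rw [AddCircle.coe_sub, sub_eq_self]
    exact (AddCircle.coe_eq_zero_iff 1).2 ⟨n, by simp⟩
  -- The window `(0,2)` contains the seam `t = 1` in its interior, and there `ψ` has a formula that
  -- is visibly smooth. Integer translates of the window cover the line.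
  have h2 : ∀ t ∈ Ioo (0 : ℝ) 2, ψ t = φ t + φ (t - 1) := by
    intro t ht
    by_cases ht1 : t ≤ 1
    · rw [h1 t ⟨ht.1, ht1⟩, h0 (t - 1) (fun h => by linarith [h.1]), add_zero]
    · rw [h0 t (fun h => ht1 h.2.le), zero_add, ← h1 (t - 1) ⟨by linarith, by linarith [ht.2]⟩]
      simpa using (hper t 1).symm
  refine ⟨ψ, ?_, fun s hs' => h1 s (Ioo_subset_Ioc_self hs'), fun s hs' => ?_⟩
  · rw [IsTest, contDiff_iff_contDiffAt]
    have hloc : ∀ s ∈ Ioo (0 : ℝ) 2, ContDiffAt ℝ ∞ (fun s : ℝ => ψ s) s := by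
      intro s hs'
      have : ContDiffAt ℝ ∞ (fun t => φ t + φ (t - 1)) s :=
        (hφ.add (hφ.comp (contDiff_id.sub contDiff_const))).contDiffAt
      refine this.congr_of_eventuallyEq ?_
      filter_upwards [isOpen_Ioo.mem_nhds hs'] with t ht using h2 t ht
    intro s
    have h3 : s - (⌈s⌉ - 1 : ℤ) ∈ Ioo (0 : ℝ) 2 := by
      push_cast
      exact ⟨by linarith [Int.ceil_lt_add_one s], by linarith [Int.le_ceil s]⟩
    have h4 : ContDiffAt ℝ ∞ ((fun s : ℝ => ψ s) ∘ fun t : ℝ => t - (⌈s⌉ - 1 : ℤ)) s :=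
      ContDiffAt.comp s (hloc _ h3) (contDiffAt_id.sub contDiffAt_const)
    refine h4.congr_of_eventuallyEq (Eventually.of_forall fun t => ?_)
    exact (hper t _).symm
  · rw [circDeriv_coe]
    refine Filter.EventuallyEq.deriv_eq ?_
    filter_upwards [isOpen_Ioo.mem_nhds hs'] with t ht using h1 t (Ioo_subset_Ioc_self ht)

omit [NormedSpace ℝ E] [CompleteSpace E] in
theorem integrableOn_coe_of_memLp {f : UnitAddCircle → E} (hf : MemLp f 2 volume) :
    IntegrableOn (fun s : ℝ => f s) (Ioc 0 1) :=
  (hf.comp_measurePreserving measurePreserving_coe_circle).integrable (by norm_num)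

/-- Test functions supported in `(0,1)` identify `f` as a primitive of `g`; the constant test
function supplies the closing condition `∫ g = 0`. Conversely, periodicity of the test function and
`∫ g = 0` cancel the boundary terms. -/
theorem isWeakDeriv_iff (f g : L2) : IsWeakDeriv f g ↔ IsAbsCont f g := by
  have hf := integrableOn_coe_of_memLp (Lp.memLp f)
  have hg := integrableOn_coe_of_memLp (Lp.memLp g)
  constructor
  · intro h
    refine ⟨hg, ?_, ?_⟩
    · have h1 := h (fun _ => 1) contDiff_const
      have h2 : circDeriv (fun _ => (1 : ℝ)) = 0 := by
        ext x; simp [circDeriv]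
      rw [h2] at h1
      simp only [Pi.zero_apply, zero_smul, integral_zero, one_smul, zero_eq_neg] at h1
      rw [intervalIntegral.integral_of_le zero_le_one, ← integral_circle, h1]
    · obtain ⟨c, hc⟩ := ae_eq_primitive_of_weakDeriv (T := 1) zero_lt_one
        (f := fun s => f s) (g := fun s => g s)
        (hf.mono_set Ioo_subset_Ioc_self) (hg.mono_set Ioo_subset_Ioc_self) (fun φ hφ _ hs => by
          obtain ⟨ψ, hψ, e1, e2⟩ := exists_isTest_extension hφ hs
          have h1 := h ψ hψ
          rw [integral_circle, integral_circle, integral_Ioc_eq_integral_Ioo,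
            integral_Ioc_eq_integral_Ioo] at h1
          rw [setIntegral_congr_fun measurableSet_Ioo fun s hs => by rw [← e2 s hs], h1,
            setIntegral_congr_fun measurableSet_Ioo fun s hs => by rw [e1 s hs]])
      exact ⟨c, by rwa [← restrict_Ioo_eq_restrict_Ioc]⟩
  · rintro ⟨-, h0, c, hc⟩ φ hφ
    have h1 := integral_deriv_smul_primitive zero_le_one c hg hφ
    have h2 : φ ((1 : ℝ) : UnitAddCircle) = φ ((0 : ℝ) : UnitAddCircle) := by
      rw [AddCircle.coe_period]; simp
    rw [h0, h2, add_zero, sub_self, zero_sub, intervalIntegral.integral_of_le zero_le_one,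
      intervalIntegral.integral_of_le zero_le_one] at h1
    rw [integral_circle, integral_circle, ← h1]
    refine integral_congr_ae ?_
    filter_upwards [hc] with s hs
    rw [hs, circDeriv_coe]

/-- If a continuous closed curve with positive chord-arc constant is `C¹`, its speed is bounded
below by the chord-arc constant. -/
theorem chordArc_le_norm_deriv {c : UnitAddCircle → Plane} {s : ℝ} {v : Plane}
    (h : HasDerivAt (fun s : ℝ => c s) v s) : chordArc c ≤ ‖v‖ := by
  refine ge_of_tendsto (hasDerivAt_iff_tendsto_slope.1 h).norm ?_
  have h1 : ∀ᶠ t in 𝓝[≠] s, t ∈ Metric.ball s (1 / 2) :=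
    mem_nhdsWithin_of_mem_nhds (Metric.ball_mem_nhds s (by norm_num))
  filter_upwards [h1, self_mem_nhdsWithin] with t ht hts
  rw [Metric.mem_ball, Real.dist_eq] at ht
  have hd : dist (t : UnitAddCircle) (s : UnitAddCircle) = |t - s| := by
    rw [dist_eq_norm, ← AddCircle.coe_sub, AddCircle.norm_coe_eq_abs_iff 1 one_ne_zero]
    simpa using ht.le
  have hpos : 0 < |t - s| := abs_pos.2 (sub_ne_zero.2 hts)
  have hne : (t : UnitAddCircle) ≠ s := by
    rw [← dist_pos, hd]; exact hpos
  have h2 : chordArc c ≤ ‖c t - c s‖ / dist (t : UnitAddCircle) s :=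
    ciInf_le (f := fun p : {p : UnitAddCircle × UnitAddCircle // p.1 ≠ p.2} =>
      ‖c p.1.1 - c p.1.2‖ / dist p.1.1 p.1.2)
      ⟨0, by rintro _ ⟨p, rfl⟩; positivity⟩ ⟨(t, s), hne⟩
  rw [hd] at h2
  rw [slope_def_module, norm_smul, norm_inv, Real.norm_eq_abs]
  rwa [div_eq_inv_mul] at h2

theorem isAbsCont_der {k : ℕ} (u : H k) (j : Fin k) :
    IsAbsCont (der u j.castSucc) (der u j.succ) :=
  (isWeakDeriv_iff _ _).1 (u.2 j)

/-- The bound is the chord-arc constant itself. As `∂ₓη` has a continuous representative `P`, the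
continuous curve is differentiable on `(0,1)` with derivative `P`, and difference quotients bound
`|P|` from below. -/
theorem exists_lower_bound_of_mem_V {η : H 2} (hη : η ∈ V) :
    ∃ κ : ℝ, 0 < κ ∧ ∀ᵐ x, κ ≤ ‖der η 1 x‖ := by
  obtain ⟨c, hc, hpos⟩ := hη
  refine ⟨_, hpos, ?_⟩
  obtain ⟨hi1, -, c0, h0⟩ : IsAbsCont (der η 0) (der η 1) := isAbsCont_der η 0
  obtain ⟨hi2, -, c1, h1⟩ : IsAbsCont (der η 1) (der η 2) := isAbsCont_der η 1
  set P : ℝ → Plane := fun s => c1 + ∫ r in (0 : ℝ)..s, der η 2 r with hP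
  have hPc : ContinuousOn P (Icc 0 1) :=
    continuousOn_const.add (continuousOn_primitive zero_le_one hi2)
  have hPi : IntegrableOn P (Ioc 0 1) := hPc.integrableOn_Icc.mono_set Ioc_subset_Icc_self
  have hcc : Continuous fun s : ℝ => c (s : UnitAddCircle) :=
    c.continuous.comp (AddCircle.continuous_mk' 1)
  -- Continuous functions that agree almost everywhere on an open interval agree everywhere on it.
  have heq : EqOn (fun s : ℝ => c (s : UnitAddCircle))
      (fun s => c0 + ∫ r in (0 : ℝ)..s, P r) (Ioo 0 1) := by
    refine Measure.eqOn_open_of_ae_eq (μ := volume) ?_ isOpen_Ioo hcc.continuousOn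
      ((continuousOn_const.add (continuousOn_primitive zero_le_one hPi)).mono Ioo_subset_Icc_self)
    rw [restrict_Ioo_eq_restrict_Ioc]
    filter_upwards [ae_circle_iff.1 hc, h0, ae_restrict_mem measurableSet_Ioc] with s e1 e2 hs
    rw [e1, toL2, e2, intervalIntegral.integral_of_le hs.1.le,
      intervalIntegral.integral_of_le hs.1.le]
    congr 1
    exact integral_congr_ae
      (ae_restrict_of_ae_restrict_of_subset (Ioc_subset_Ioc_right hs.2) h1)
  rw [ae_circle_iff, ← restrict_Ioo_eq_restrict_Ioc]
  have h1' := h1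
  rw [← restrict_Ioo_eq_restrict_Ioc] at h1'
  filter_upwards [h1', ae_restrict_mem measurableSet_Ioo] with s e hs
  rw [e]
  refine chordArc_le_norm_deriv (c := c) (s := s) ?_
  have hPs : ContinuousOn P (Ioo 0 1) := hPc.mono Ioo_subset_Icc_self
  have hd : HasDerivAt (fun s => c0 + ∫ r in (0 : ℝ)..s, P r) (P s) s := by
    refine (intervalIntegral.integral_hasDerivAt_right ?_ ?_ ?_).const_add c0
    · exact (intervalIntegrable_iff_integrableOn_Ioc_of_le hs.1.le).2
        (hPi.mono_set (Ioc_subset_Ioc_right hs.2.le))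
    · exact hPs.stronglyMeasurableAtFilter isOpen_Ioo s hs
    · exact hPs.continuousAt (isOpen_Ioo.mem_nhds hs)
  refine hd.congr_of_eventuallyEq ?_
  filter_upwards [isOpen_Ioo.mem_nhds hs] with t ht using heq ht

end Circle

/-! ### The Volterra operator and zero initial values in `L²(0,T;X)`. -/

section Time

variable {X : Type*} [NormedAddCommGroup X] [InnerProductSpace ℝ X] [CompleteSpace X]

theorem integral_norm_le_of_finite {α E : Type*} [MeasurableSpace α] (μ : Measure α)
    [IsFiniteMeasure μ] [NormedAddCommGroup E] (f : Lp E 2 μ) :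
    ∫ x, ‖f x‖ ∂μ ≤ (μ univ ^ (1 / 2 : ℝ)).toReal * ‖f‖ := by
  have hm := (Lp.memLp f).aestronglyMeasurable
  have h := eLpNorm_le_eLpNorm_mul_rpow_measure_univ (μ := μ) (p := 1) (q := 2) (by norm_num) hm
  rw [integral_norm_eq_lintegral_enorm hm, ← eLpNorm_one_eq_lintegral_enorm, Lp.norm_def,
    ← ENNReal.toReal_mul]
  refine ENNReal.toReal_mono ?_ (h.trans_eq ?_)
  · exact ENNReal.mul_ne_top (ENNReal.rpow_ne_top_of_nonneg (by norm_num) (measure_ne_top _ _))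
      (Lp.eLpNorm_ne_top f)
  · rw [mul_comm]
    norm_num

omit [InnerProductSpace ℝ X] [CompleteSpace X] in
theorem integrableOn_timeL2 {T : ℝ} (f : TimeL2 T X) : IntegrableOn f (Ioc 0 T) := by
  rw [IntegrableOn, ← restrict_Ioo_eq_restrict_Ioc]
  exact (Lp.memLp f).integrable (by norm_num)

omit [CompleteSpace X] in
theorem intervalIntegral_congr_time {T : ℝ} {f g : ℝ → X} (h : f =ᵐ[timeMeasure T] g) {t : ℝ}
    (ht : t ∈ Icc 0 T) : ∫ r in 0..t, f r = ∫ r in 0..t, g r := by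
  rw [intervalIntegral.integral_of_le ht.1, intervalIntegral.integral_of_le ht.1]
  rw [timeMeasure, restrict_Ioo_eq_restrict_Ioc] at h
  exact integral_congr_ae (ae_restrict_of_ae_restrict_of_subset (Ioc_subset_Ioc_right ht.2) h)

theorem exists_timePrimitive (X : Type*) [NormedAddCommGroup X] [InnerProductSpace ℝ X]
    [CompleteSpace X] {T : ℝ} (hT : 0 < T) :
    ∃ J : TimeL2 T X →L[ℝ] TimeL2 T X, ∀ f : TimeL2 T X,
      ∀ᵐ t ∂timeMeasure T, J f t = ∫ r in 0..t, f r := by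
  have hbound : ∀ f : TimeL2 T X, ∀ᵐ t ∂timeMeasure T,
      ‖∫ r in 0..t, f r‖ ≤ (timeMeasure T univ ^ (1 / 2 : ℝ)).toReal * ‖f‖ := by
    intro f
    filter_upwards [ae_restrict_mem measurableSet_Ioo] with t ht
    refine le_trans ?_ (integral_norm_le_of_finite (timeMeasure T) f)
    refine (intervalIntegral.norm_integral_le_integral_norm ht.1.le).trans ?_
    rw [intervalIntegral.integral_of_le ht.1.le,
      show ∫ r, ‖f r‖ ∂timeMeasure T = ∫ r in Ioc 0 T, ‖f r‖ from
        integral_Ioc_eq_integral_Ioo.symm]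
    exact setIntegral_mono_set (integrableOn_timeL2 f).norm
      (Eventually.of_forall fun _ => norm_nonneg _) (Ioc_subset_Ioc_right ht.2.le).eventuallyLE
  have hmem : ∀ f : TimeL2 T X, MemLp (fun t => ∫ r in 0..t, f r) 2 (timeMeasure T) := fun f =>
    MemLp.of_bound (((continuousOn_primitive hT.le (integrableOn_timeL2 f)).mono
      Ioo_subset_Icc_self).aestronglyMeasurable measurableSet_Ioo) _ (hbound f)
  have hii : ∀ (f : TimeL2 T X), ∀ t ∈ Ioo 0 T, IntervalIntegrable f volume 0 t := fun f t ht =>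
    (intervalIntegrable_iff_integrableOn_Ioc_of_le ht.1.le).2
      ((integrableOn_timeL2 f).mono_set (Ioc_subset_Ioc_right ht.2.le))
  let J₀ : TimeL2 T X →ₗ[ℝ] TimeL2 T X :=
    { toFun := fun f => (hmem f).toLp _
      map_add' := by
        intro f g
        rw [← MemLp.toLp_add]
        refine MemLp.toLp_congr _ _ ?_
        filter_upwards [ae_restrict_mem measurableSet_Ioo] with t ht
        rw [intervalIntegral_congr_time (Lp.coeFn_add f g) (Ioo_subset_Icc_self ht)]
        exact intervalIntegral.integral_add (hii f t ht) (hii g t ht)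
      map_smul' := by
        intro a f
        rw [RingHom.id_apply, ← MemLp.toLp_const_smul]
        refine MemLp.toLp_congr _ _ ?_
        filter_upwards [ae_restrict_mem measurableSet_Ioo] with t ht
        rw [intervalIntegral_congr_time (Lp.coeFn_smul a f) (Ioo_subset_Icc_self ht)]
        exact intervalIntegral.integral_smul a f }
  refine ⟨J₀.mkContinuous ((measureUnivNNReal (timeMeasure T) : ℝ) ^ (2 : ℝ≥0∞).toReal⁻¹ *
    (timeMeasure T univ ^ (1 / 2 : ℝ)).toReal) fun f => ?_, fun f => (hmem f).coeFn_toLp⟩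
  rw [mul_assoc]
  refine Lp.norm_le_of_ae_bound (mul_nonneg ENNReal.toReal_nonneg (norm_nonneg f)) ?_
  filter_upwards [hbound f, (hmem f).coeFn_toLp] with t h1 h2
  exact (congrArg norm h2).trans_le h1

/-- The Volterra operator `f ↦ ∫₀ᵗ f` on `L²(0,T;X)`. -/
def timePrimitive (X : Type*) [NormedAddCommGroup X] [InnerProductSpace ℝ X]
    [CompleteSpace X] {T : ℝ} (hT : 0 < T) : TimeL2 T X →L[ℝ] TimeL2 T X :=
  (exists_timePrimitive X hT).choose

theorem timePrimitive_ae {T : ℝ} (hT : 0 < T) (f : TimeL2 T X) :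
    ∀ᵐ t ∂timeMeasure T, timePrimitive X hT f t = ∫ r in 0..t, f r :=
  (exists_timePrimitive X hT).choose_spec f

theorem timePrimitive_compLpL {T : ℝ} (hT : 0 < T) (R : X →L[ℝ] X) (f : TimeL2 T X) :
    timePrimitive X hT (R.compLpL 2 (timeMeasure T) f) =
      R.compLpL 2 (timeMeasure T) (timePrimitive X hT f) := by
  refine Lp.ext ?_
  filter_upwards [timePrimitive_ae hT f, timePrimitive_ae hT (R.compLpL 2 (timeMeasure T) f),
    R.coeFn_compLpL (p := 2) (μ := timeMeasure T) (timePrimitive X hT f),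
    ae_restrict_mem measurableSet_Ioo] with t h1 h2 h3 ht
  rw [h2, h3, h1, intervalIntegral_congr_time (R.coeFn_compLpL (p := 2) (μ := timeMeasure T) f)
    (Ioo_subset_Icc_self ht)]
  exact R.intervalIntegral_comp_comm ((intervalIntegrable_iff_integrableOn_Ioc_of_le ht.1.le).2
      ((integrableOn_timeL2 f).mono_set (Ioc_subset_Ioc_right ht.2.le)))

/-- The Volterra operator is accretive with respect to any positive semidefinite form. -/
theorem inner_compLpL_timePrimitive_nonneg {T : ℝ} (hT : 0 < T) (B : X →L[ℝ] X)
    (hsymm : ∀ x y, inner ℝ (B x) y = inner ℝ (B y) x) (hpos : ∀ x, 0 ≤ inner ℝ (B x) x)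
    (f : TimeL2 T X) :
    0 ≤ inner ℝ (B.compLpL 2 (timeMeasure T) f) (timePrimitive X hT f) := by
  let β : X →L[ℝ] X →L[ℝ] ℝ := (innerSL ℝ : X →L[ℝ] X →L[ℝ] ℝ).comp B
  have hβ : ∀ x y, β x y = inner ℝ (B x) y := fun x y => rfl
  have h := integral_bilin_primitive β hT.le 0 0 (integrableOn_timeL2 f) (integrableOn_timeL2 f)
  have h1 : inner ℝ (B.compLpL 2 (timeMeasure T) f) (timePrimitive X hT f) =
      ∫ t in 0..T, β (f t) (∫ r in 0..t, f r) := by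
    rw [L2.inner_def, intervalIntegral.integral_of_le hT.le, integral_Ioc_eq_integral_Ioo]
    refine integral_congr_ae ?_
    filter_upwards [timePrimitive_ae hT f, B.coeFn_compLpL (p := 2) (μ := timeMeasure T) f]
      with t h1 h2
    rw [h1, h2, hβ]
  simp only [zero_add, map_zero, sub_zero] at h
  -- By symmetry the integrand is half the derivative of `β F F` with `F = ∫₀ᵗ f`, so the integral
  -- is `½ β (F T) (F T)`.
  have h2 : ∀ t, β (f t) (∫ r in 0..t, f r) + β (∫ r in 0..t, f r) (f t) =
      2 * β (f t) (∫ r in 0..t, f r) := by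
    intro t
    rw [hβ, hβ, hsymm (∫ r in 0..t, f r)]
    ring
  simp only [h2] at h
  rw [intervalIntegral.integral_const_mul] at h
  have h3 := hpos (∫ t in 0..T, f t)
  rw [← hβ] at h3
  rw [h1]
  linarith

theorem mem_timeH1_timePrimitive {T : ℝ} (hT : 0 < T) (p : TimeL2 T X) :
    WithLp.toLp 2 (timePrimitive X hT p, p) ∈ TimeH1 T X := by
  intro φ hφ _ hs
  have hφ0 : φ 0 = 0 := image_eq_zero_of_notMem_tsupport fun h' => lt_irrefl _ (hs h').1
  have hφT : φ T = 0 := image_eq_zero_of_notMem_tsupport fun h' => lt_irrefl _ (hs h').2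
  have h1 := integral_deriv_smul_primitive hT.le 0 (integrableOn_timeL2 p) hφ
  simp only [intervalIntegral.integral_of_le hT.le, integral_Ioc_eq_integral_Ioo, hφ0, hφT,
      zero_smul, zero_add, sub_zero, zero_sub] at h1
  change ∫ t in Ioo 0 T, deriv φ t • timePrimitive X hT p t = -∫ t in Ioo 0 T, φ t • p t
  rw [← h1]
  refine integral_congr_ae ?_
  filter_upwards [timePrimitive_ae hT p] with t ht
  rw [ht]

/-- A weak derivative determines `u` up to a constant of integration. Continuity of `c` on the
closed interval makes that constant equal to `c 0`, which is how the initial condition enters. -/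
theorem eq_timePrimitive_of_mem_timeH1 {T : ℝ} (hT : 0 < T) {u p : TimeL2 T X}
    (h : WithLp.toLp 2 (u, p) ∈ TimeH1 T X) {c : ℝ → X} (hc : ContinuousOn c (Icc 0 T))
    (hcu : c =ᵐ[timeMeasure T] u) (h0 : c 0 = 0) : u = timePrimitive X hT p := by
  have hioo : ∀ f : TimeL2 T X, IntegrableOn f (Ioo 0 T) := fun f =>
    (integrableOn_timeL2 f).mono_set Ioo_subset_Ioc_self
  obtain ⟨a, ha⟩ := ae_eq_primitive_of_weakDeriv hT (hioo u) (hioo p)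
    (fun φ h1 h2 h3 => h φ h1 h2 h3)
  have hcont : ContinuousOn (fun t => a + ∫ r in 0..t, p r) (Icc 0 T) :=
    continuousOn_const.add (continuousOn_primitive hT.le (integrableOn_timeL2 p))
  have heq : EqOn c (fun t => a + ∫ r in 0..t, p r) (Icc 0 T) := by
    refine Measure.eqOn_Icc_of_ae_eq volume hT.ne ?_ hc hcont
    rw [← restrict_Ioo_eq_restrict_Icc]
    filter_upwards [hcu, ha] with t h1 h2
    rw [h1, h2]
  have ha0 : a = 0 := by
    have := heq (left_mem_Icc.2 hT.le)
    simpa [h0] using this.symm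
  refine Lp.ext ?_
  filter_upwards [ha, timePrimitive_ae hT p] with t h1 h2
  rw [h1, h2, ha0, zero_add]

end Time

/-! ### A sum equation for two commuting operators in Hilbert space. -/

section Abstract

variable {L : Type*} [NormedAddCommGroup L] [InnerProductSpace ℝ L] [CompleteSpace L]

/-- Solvability of `p + q = g`, `J p = R (J p + q)` for commuting operators `R`, `J`, where `R` is a
resolvent that is symmetric for the form `⟪G ·, ·⟫` and `J` is accretive. -/
theorem existsUnique_sum_of_commuting (G R J : L →L[ℝ] L) {κ : ℝ} (hκ : 0 < κ)
    (hG : ∀ x y, inner ℝ (G x) y = inner ℝ (G y) x)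
    (hcoer : ∀ x, κ * ‖x‖ ^ 2 ≤ inner ℝ (G x) x)
    (hR : ∀ x y, inner ℝ (G (R x)) y = inner ℝ (G x) (R y))
    (hRinj : ∀ x, R x = 0 → x = 0) (hJR : ∀ x, J (R x) = R (J x))
    (hpos : ∀ x, 0 ≤ inner ℝ (G (R x)) (J (x - R x)))
    (hpos' : ∀ x, 0 ≤ inner ℝ (G (R (J x))) (x - R x)) :
    (∀ g, ∃! p, J p = R (J p + g - p)) ∧
      ∃ C : ℝ, 0 < C ∧ ∀ g p, J p = R (J p + g - p) → ‖p‖ ≤ C * ‖g‖ := by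
  -- With `p = R h` and `q = J (h - R h)`, commutation gives `J p + q = J h`, so `J p = R (J p + q)`
  -- holds automatically and only `p + q = S h = g` remains.
  set S : L →L[ℝ] L := R + J.comp (ContinuousLinearMap.id ℝ L - R) with hS
  have hSx : ∀ x, S x = R x + J (x - R x) := fun x => by simp [S]
  obtain ⟨K, hK, hest⟩ : ∃ K : ℝ, 0 < K ∧ ∀ x, ‖R x‖ ≤ K * ‖S x‖ := by
    -- From `κ‖R x‖² ≤ ⟪G S x, S x⟫ ≤ ‖G‖‖S x‖²`; the added `1` keeps the constant positive when `G
    -- = 0`.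
    refine ⟨Real.sqrt ((‖G‖ + 1) / κ), by positivity, fun x => ?_⟩
    have h1 : inner ℝ (G (S x)) (S x) = inner ℝ (G (R x)) (R x) +
        2 * inner ℝ (G (R x)) (J (x - R x)) + inner ℝ (G (J (x - R x))) (J (x - R x)) := by
      rw [hSx, map_add, inner_add_left, inner_add_right, inner_add_right,
        hG (J (x - R x)) (R x)]
      ring
    have h2 := hcoer (R x)
    have h3 : 0 ≤ inner ℝ (G (J (x - R x))) (J (x - R x)) :=
      le_trans (by positivity) (hcoer _)
    have h4 : inner ℝ (G (S x)) (S x) ≤ ‖G‖ * ‖S x‖ * ‖S x‖ :=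
      (real_inner_le_norm _ _).trans (by gcongr; exact G.le_opNorm _)
    have h5 := hpos x
    have h6 : κ * ‖R x‖ ^ 2 ≤ (‖G‖ + 1) * ‖S x‖ ^ 2 := by nlinarith [sq_nonneg ‖S x‖]
    have h7 : ‖R x‖ ^ 2 ≤ (‖G‖ + 1) / κ * ‖S x‖ ^ 2 := by
      rw [div_mul_eq_mul_div, le_div_iff₀ hκ]
      linarith
    calc ‖R x‖ = Real.sqrt (‖R x‖ ^ 2) := (Real.sqrt_sq (norm_nonneg _)).symm
      _ ≤ Real.sqrt ((‖G‖ + 1) / κ * ‖S x‖ ^ 2) := Real.sqrt_le_sqrt h7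
      _ = _ := by rw [Real.sqrt_mul (by positivity), Real.sqrt_sq (norm_nonneg _)]
  have hdense : DenseRange S := by
    have : (S : L →ₗ[ℝ] L).range.topologicalClosure = ⊤ := by
      rw [Submodule.topologicalClosure_eq_top_iff, Submodule.eq_bot_iff]
      intro z hz
      have hcoer' : IsCoercive ((innerSL ℝ : L →L[ℝ] L →L[ℝ] ℝ).comp G) :=
        ⟨κ, hκ, fun x => by
          have := hcoer x
          rw [pow_two, ← mul_assoc] at this
          exact this⟩
      -- Lax–Milgram writes a vector `z` orthogonal to the range as `G w`. Testing against `S (R w)`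
      -- gives a sum of two nonnegative terms, one of them at least `κ‖R w‖²`, so `R w = 0` and `w =
      -- 0`.
      obtain ⟨w, hw⟩ := (LinearMap.range_eq_top.1 hcoer'.range_eq_top) z
      have hwG : ∀ y, inner ℝ z y = inner ℝ (G w) y := by
        intro y
        rw [← hw]
        exact InnerProductSpace.continuousLinearMapOfBilin_apply _ w y
      have h0 : inner ℝ (G w) (S (R w)) = 0 := by
        rw [← hwG, real_inner_comm]
        exact hz _ ⟨R w, rfl⟩
      have hJN : J (R w - R (R w)) = R (J (w - R w)) := by rw [← map_sub, hJR]
      have h1 : inner ℝ (G w) (R (R w)) = inner ℝ (G (R w)) (R w) := (hR w (R w)).symm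
      have h2 : inner ℝ (G w) (R (J (w - R w))) = inner ℝ (G (R (J w))) (w - R w) := by
        rw [← hR, map_sub, inner_sub_right, inner_sub_right, hJR, ← hR, hG (R w) (J w),
          hR (J w), hG (R (R w)) (J w), hR (J w)]
      have h3 := hpos' w
      rw [hSx, inner_add_right, hJN, h1, h2] at h0
      have h4 := hcoer (R w)
      have h5 : ‖R w‖ = 0 := by
        have : ‖R w‖ ^ 2 ≤ 0 := by nlinarith
        exact pow_eq_zero_iff (two_ne_zero) |>.1 (le_antisymm this (sq_nonneg _))
      have h6 := hRinj w (norm_eq_zero.1 h5)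
      rw [← inner_self_eq_zero (𝕜 := ℝ), hwG, h6, map_zero, inner_zero_left]
    exact Submodule.dense_iff_topologicalClosure_eq_top.2 this
  -- Commutation turns the homogeneous equation into `S p = 0`; the estimate then kills `R p`, and
  -- `R` is injective.
  have huniq : ∀ p, J p = R (J p - p) → p = 0 := by
    intro p hp
    have h1 : S p = 0 := by
      rw [hSx, map_sub, hJR]
      conv_lhs => enter [2, 1]; rw [hp]
      rw [← map_sub, ← map_add]
      simp
    have h2 := hest p
    rw [h1, norm_zero, mul_zero] at h2
    exact hRinj p (norm_le_zero_iff.1 h2)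
  have hexist : ∀ g, ∃ p, J p = R (J p + g - p) ∧ ‖p‖ ≤ K * ‖g‖ := by
    intro g
    obtain ⟨y, hy, hyg⟩ := mem_closure_iff_seq_limit.1 (hdense g)
    choose h hh using hy
    have hSh : Tendsto (fun n => S (h n)) atTop (𝓝 g) := by simpa only [hh] using hyg
    -- The estimate controls `R h`, not `h`: the sequence `h n` itself need not converge, but `p`
    -- and `q` do, and `J p = R (J p + q)` is a closed relation.
    have hcau : CauchySeq fun n => R (h n) := by
      have h1 := hSh.cauchySeq
      rw [Metric.cauchySeq_iff] at h1 ⊢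
      intro ε hε
      obtain ⟨N, hN⟩ := h1 (ε / K) (by positivity)
      refine ⟨N, fun m hm n hn => ?_⟩
      have h2 := hN m hm n hn
      rw [dist_eq_norm, ← map_sub] at h2 ⊢
      rw [lt_div_iff₀ hK, mul_comm] at h2
      exact (hest _).trans_lt h2
    obtain ⟨p, hp⟩ := cauchySeq_tendsto_of_complete hcau
    have hq : Tendsto (fun n => J (h n - R (h n))) atTop (𝓝 (g - p)) := by
      have := hSh.sub hp
      refine this.congr fun n => ?_
      rw [hSx]; abel
    have hJp : Tendsto (fun n => J (R (h n))) atTop (𝓝 (J p)) := (J.continuous.tendsto p).comp hp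
    have hRq := (R.continuous.tendsto _).comp (hJp.add hq)
    refine ⟨p, ?_, le_of_tendsto_of_tendsto hp.norm (hSh.norm.const_mul K)
      (Eventually.of_forall fun n => hest _)⟩
    rw [add_sub_assoc]
    refine tendsto_nhds_unique hJp (hRq.congr fun n => ?_)
    simp only [Function.comp]
    rw [← map_add, add_sub_cancel, hJR]
  have huniq' : ∀ g p p', J p = R (J p + g - p) → J p' = R (J p' + g - p') → p = p' := by
    intro g p p' hp hp'
    rw [← sub_eq_zero]
    refine huniq _ ?_
    have h1 : J p - J p' - (p - p') = (J p + g - p) - (J p' + g - p') := by abel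
    rw [map_sub, h1, map_sub, ← hp, ← hp']
  refine ⟨fun g => ?_, K, hK, fun g p hp => ?_⟩
  · obtain ⟨p, hp, -⟩ := hexist g
    exact ⟨p, hp, fun p' hp' => huniq' g _ _ hp' hp⟩
  · obtain ⟨p', hp', hb⟩ := hexist g
    rwa [huniq' g p p' hp hp']

end Abstract

/-! ### Maximal regularity for a pair of symmetric forms. -/

section Evolution

variable {X : Type*} [NormedAddCommGroup X] [InnerProductSpace ℝ X] [CompleteSpace X]

/-- Lax–Milgram for `M + D`. Keeping `M` on the right makes `R` the resolvent of the generator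
formally given by `-M⁻¹D`, without inverting `M`, which is not coercive on `X = H¹` in the
application. -/
theorem exists_resolvent (M D : X →L[ℝ] X) {κ : ℝ} (hκ : 0 < κ)
    (hcoer : ∀ x, κ * ‖x‖ ^ 2 ≤ inner ℝ (M x + D x) x) :
    ∃ R : X →L[ℝ] X, ∀ x, M (R x) + D (R x) = M x := by
  have hc : IsCoercive ((innerSL ℝ : X →L[ℝ] X →L[ℝ] ℝ).comp (M + D)) :=
    ⟨κ, hκ, fun x => by
      have := hcoer x
      rw [pow_two, ← mul_assoc] at this
      exact this⟩
  refine ⟨(hc.continuousLinearEquivOfBilin.symm : X →L[ℝ] X).comp M, fun x => ?_⟩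
  refine ext_inner_right ℝ fun y => ?_
  have := hc.continuousLinearEquivOfBilin_apply (hc.continuousLinearEquivOfBilin.symm (M x)) y
  rw [ContinuousLinearEquiv.apply_symm_apply] at this
  exact this.symm

/-- Maximal `L²`-regularity for `M u' + D u = M g`, `u(0) = 0`, written in terms of `p = u'` and the
resolvent `R = (M + D)⁻¹ M`. -/
theorem existsUnique_evolution {T : ℝ} (hT : 0 < T) (M D R : X →L[ℝ] X) {κ : ℝ} (hκ : 0 < κ)
    (hM : ∀ x y, inner ℝ (M x) y = inner ℝ (M y) x) (hD : ∀ x y, inner ℝ (D x) y = inner ℝ (D y) x)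
    (hM0 : ∀ x, 0 ≤ inner ℝ (M x) x) (hD0 : ∀ x, 0 ≤ inner ℝ (D x) x)
    (hMinj : ∀ x, inner ℝ (M x) x = 0 → x = 0)
    (hcoer : ∀ x, κ * ‖x‖ ^ 2 ≤ inner ℝ (M x + D x) x)
    (hR : ∀ x, M (R x) + D (R x) = M x) :
    (∀ g : TimeL2 T X, ∃! p : TimeL2 T X, timePrimitive X hT p =
      R.compLpL 2 (timeMeasure T) (timePrimitive X hT p + g - p)) ∧
      ∃ C : ℝ, 0 < C ∧ ∀ g p : TimeL2 T X, timePrimitive X hT p =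
        R.compLpL 2 (timeMeasure T) (timePrimitive X hT p + g - p) → ‖p‖ ≤ C * ‖g‖ := by
  have hMR : ∀ x y, inner ℝ (M (R x)) y + inner ℝ (D (R x)) y = inner ℝ (M x) y := fun x y => by
    rw [← hR x, inner_add_left]
  have hsym : ∀ x y, inner ℝ (M x) (R y) = inner ℝ (M y) (R x) := by
    intro x y
    rw [← hMR x (R y), ← hMR y (R x), hM (R x), hD (R x)]
  set N : X →L[ℝ] X := ContinuousLinearMap.id ℝ X - R with hN
  have hNx : ∀ x, N x = x - R x := fun x => by simp [N]
  -- Since `G R = M`, the cross term `⟪G R x, J (x - R x)⟫` becomes `⟪B x, J x⟫`.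
  set B : X →L[ℝ] X := (ContinuousLinearMap.adjoint N).comp M with hB
  have hBx : ∀ x y, inner ℝ (B x) y = inner ℝ (M x) (y - R y) := fun x y => by
    rw [hB, ContinuousLinearMap.comp_apply, ContinuousLinearMap.adjoint_inner_left, hNx]
  have hBs : ∀ x y, inner ℝ (B x) y = inner ℝ (B y) x := by
    intro x y
    rw [hBx, hBx, inner_sub_right, inner_sub_right, hM x y, hsym x y]
  -- `⟪B x, x⟫ = ⟪M (x - R x), x - R x⟫ + ⟪D (R x), R x⟫`.
  have hB0 : ∀ x, 0 ≤ inner ℝ (B x) x := by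
    intro x
    have h1 := hM0 (x - R x)
    have h2 := hD0 (R x)
    have h3 := hMR x (R x)
    rw [map_sub, inner_sub_left, inner_sub_right, inner_sub_right, hM (R x) x] at h1
    rw [hBx, inner_sub_right]
    linarith
  set G : X →L[ℝ] X := M + D with hG
  have hGx : ∀ x, G x = M x + D x := fun x => rfl
  have ae : ∀ (P : X →L[ℝ] X) (f : TimeL2 T X),
      ∀ᵐ t ∂timeMeasure T, P.compLpL 2 (timeMeasure T) f t = P (f t) := fun P f =>
    P.coeFn_compLpL f
  have hpos : ∀ x : TimeL2 T X, inner ℝ (G.compLpL 2 (timeMeasure T)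
      (R.compLpL 2 (timeMeasure T) x)) (timePrimitive X hT (x - R.compLpL 2 (timeMeasure T) x)) =
      inner ℝ (B.compLpL 2 (timeMeasure T) x) (timePrimitive X hT x) := by
    intro x
    rw [map_sub, timePrimitive_compLpL, L2.inner_def, L2.inner_def]
    refine integral_congr_ae ?_
    filter_upwards [ae G (R.compLpL 2 (timeMeasure T) x), ae R x, ae B x,
      ae R (timePrimitive X hT x), Lp.coeFn_sub (timePrimitive X hT x)
        (R.compLpL 2 (timeMeasure T) (timePrimitive X hT x))] with t h1 h2 h3 h4 h5
    rw [h1, h2, h3, h5, Pi.sub_apply, h4, hGx, hR, hBx]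
  refine existsUnique_sum_of_commuting (G.compLpL 2 (timeMeasure T)) (R.compLpL 2 (timeMeasure T))
    (timePrimitive X hT) hκ ?_ ?_ ?_ ?_ ?_ ?_ ?_
  · intro x y
    rw [L2.inner_def, L2.inner_def]
    refine integral_congr_ae ?_
    filter_upwards [ae G x, ae G y] with t h1 h2
    rw [h1, h2, hGx, hGx, inner_add_left, inner_add_left, hM, hD]
  · intro x
    rw [← real_inner_self_eq_norm_sq, L2.inner_def, L2.inner_def, ← integral_const_mul]
    refine integral_mono_ae ((L2.integrable_inner x x).const_mul κ) (L2.integrable_inner _ _) ?_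
    filter_upwards [ae G x] with t h1
    rw [h1, real_inner_self_eq_norm_sq]
    exact hcoer _
  · intro x y
    rw [L2.inner_def, L2.inner_def]
    refine integral_congr_ae ?_
    filter_upwards [ae G x, ae R x, ae R y, ae G (R.compLpL 2 (timeMeasure T) x)] with t h1 h2 h3 h4
    rw [h1, h3, h4, h2, hGx, hGx, hR, inner_add_left, hM (x t) (R (y t)),
      hD (x t) (R (y t)), hMR, hM]
  · intro x hx
    refine Lp.ext ?_
    have h0 := Lp.coeFn_zero X 2 (timeMeasure T)
    filter_upwards [ae R x, h0] with t h1 h2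
    rw [hx, h2] at h1
    rw [h2]
    refine hMinj _ ?_
    rw [← hR, ← h1]
    simp
  · exact fun x => timePrimitive_compLpL hT R x
  · intro x
    rw [hpos]
    exact inner_compLpL_timePrimitive_nonneg hT B hBs hB0 x
  · intro x
    refine (inner_compLpL_timePrimitive_nonneg hT B hBs hB0 x).trans_eq ?_
    rw [L2.inner_def, L2.inner_def]
    refine integral_congr_ae ?_
    filter_upwards [ae G (R.compLpL 2 (timeMeasure T) (timePrimitive X hT x)), ae R x, ae B x,
      ae R (timePrimitive X hT x), Lp.coeFn_sub x (R.compLpL 2 (timeMeasure T) x)]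
      with t h1 h2 h3 h4 h5
    rw [h1, h4, h3, h5, Pi.sub_apply, h2, hGx, hR, ← hBx, hBs]

end Evolution

/-! ### Uniqueness of weak derivatives, and multipliers on `H¹` of the circle. -/

section Sobolev

theorem ext_of_forall_isTest {g : L2} (h : ∀ φ : UnitAddCircle → ℝ, IsTest φ →
    ∫ x, φ x • g x = 0) : g = 0 := by
  have hg := integrableOn_coe_of_memLp (Lp.memLp g)
  refine Lp.ext ?_
  have h0 := Lp.coeFn_zero Plane 2 (volume : Measure UnitAddCircle)
  suffices ∀ᵐ x, g x = 0 by
    filter_upwards [this, h0] with x h1 h2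
    rw [h1, h2]; rfl
  rw [ae_circle_iff, ← restrict_Ioo_eq_restrict_Ioc, ae_restrict_iff' measurableSet_Ioo]
  refine isOpen_Ioo.ae_eq_zero_of_integral_contDiff_smul_eq_zero
    (f := fun s : ℝ => g (s : UnitAddCircle)) ?_ fun φ hφ _ hs => ?_
  · exact (hg.mono_set Ioo_subset_Ioc_self).locallyIntegrableOn
  · obtain ⟨ψ, hψ, e1, -⟩ := exists_isTest_extension hφ hs
    have h1 := h ψ hψ
    rw [integral_circle, integral_Ioc_eq_integral_Ioo,
      setIntegral_congr_fun measurableSet_Ioo fun s hs => by rw [e1 s hs]] at h1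
    rw [← h1]
    refine (setIntegral_eq_integral_of_forall_compl_eq_zero fun t ht => ?_).symm
    rw [image_eq_zero_of_notMem_tsupport fun h => ht (hs h), zero_smul]

theorem IsWeakDeriv.unique {f g g' : L2} (h : IsWeakDeriv f g) (h' : IsWeakDeriv f g') :
    g = g' := by
  rw [← sub_eq_zero]
  refine ext_of_forall_isTest fun φ hφ => ?_
  obtain ⟨L, hL⟩ := exists_testPairing (E := Plane) (memLp_circle hφ.continuous)
  have h1 := h φ hφ
  rw [h' φ hφ, neg_inj, hL, hL] at h1
  rw [hL, map_sub, h1, sub_self]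

theorem der_succ_eq_of_der_castSucc_eq {k l : ℕ} {u : H k} {v : H l} {i : Fin k} {j : Fin l}
    (h : der u i.castSucc = der v j.castSucc) : der u i.succ = der v j.succ := by
  have h1 : IsWeakDeriv (der u i.castSucc) (der u i.succ) := u.2 i
  have h2 : IsWeakDeriv (der v j.castSucc) (der v j.succ) := v.2 j
  rw [h] at h1
  exact h1.unique h2

/-- Weak derivatives are unique, so the recorded tuple carries no freedom. Elements of `E T` match
their `H¹` and `H³` versions only as `L²` functions, and this recovers the rest. -/
theorem toL2_injective (k : ℕ) : Function.Injective (toL2 : H k → L2) := by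
  intro u v h
  have h1 : ∀ j : Fin (k + 1), der u j = der v j := by
    intro j
    induction j using Fin.induction with
    | zero => exact h
    | succ i ih => exact der_succ_eq_of_der_castSucc_eq ih
  exact Subtype.ext (PiLp.ext h1)

/-- `u ↦ ∂ₓʲ u` as a continuous linear map. -/
def derL {k : ℕ} (j : Fin (k + 1)) : H k →L[ℝ] L2 :=
  (PiLp.proj 2 (fun _ : Fin (k + 1) => L2) j).comp (H k).subtypeL

@[simp]
theorem derL_apply {k : ℕ} (j : Fin (k + 1)) (u : H k) : derL j u = der u j := rfl

theorem norm_der_le {k : ℕ} (u : H k) (j : Fin (k + 1)) : ‖der u j‖ ≤ ‖u‖ :=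
  PiLp.norm_apply_le (u : PiLp 2 (fun _ : Fin (k + 1) => L2)) j

theorem norm_sq_H1 (u : H 1) : ‖u‖ ^ 2 = ‖der u 0‖ ^ 2 + ‖der u 1‖ ^ 2 := by
  have := PiLp.norm_sq_eq_of_L2 (fun _ : Fin 2 => L2) (u : PiLp 2 (fun _ : Fin (1 + 1) => L2))
  rw [Fin.sum_univ_two] at this
  exact this

/-- A continuous linear map into `Hᵏ` from its components. -/
def mkHL {k : ℕ} {Y : Type*} [NormedAddCommGroup Y] [NormedSpace ℝ Y]
    (L : Fin (k + 1) → Y →L[ℝ] L2)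
    (h : ∀ (y : Y) (j : Fin k), IsWeakDeriv (L j.castSucc y) (L j.succ y)) : Y →L[ℝ] H k :=
  (((PiLp.continuousLinearEquiv 2 ℝ (fun _ : Fin (k + 1) => L2)).symm :
    (Fin (k + 1) → L2) →L[ℝ] PiLp 2 (fun _ : Fin (k + 1) => L2)).comp
      (ContinuousLinearMap.pi L)).codRestrict (H k) h

theorem der_mkHL {k : ℕ} {Y : Type*} [NormedAddCommGroup Y] [NormedSpace ℝ Y]
    (L : Fin (k + 1) → Y →L[ℝ] L2)
    (h : ∀ (y : Y) (j : Fin k), IsWeakDeriv (L j.castSucc y) (L j.succ y)) (y : Y)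
    (j : Fin (k + 1)) : der (mkHL L h y) j = L j y := rfl

theorem isAbsCont_H1 (u : H 1) : IsAbsCont (der u 0) (der u 1) := isAbsCont_der u 0

theorem exists_sup_bound :
    ∃ C : ℝ, 0 ≤ C ∧ ∀ u : H 1, ∀ᵐ x, ‖der u 0 x‖ ≤ C * ‖u‖ := by
  set K := ((volume : Measure UnitAddCircle) univ ^ (1 / 2 : ℝ)).toReal with hK
  have hK0 : 0 ≤ K := ENNReal.toReal_nonneg
  -- One `K` for `∫‖u‖` and two for `2 ∫‖∂ₓu‖`, each by Cauchy–Schwarz.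
  refine ⟨3 * K, by positivity, fun u => ?_⟩
  filter_upwards [(isAbsCont_H1 u).norm_le] with x hx
  have h0 := integral_norm_le_of_finite volume (der u 0)
  have h1 := integral_norm_le_of_finite volume (der u 1)
  have h2 : K * ‖der u 0‖ ≤ K * ‖u‖ := by gcongr; exact norm_der_le u 0
  have h3 : K * ‖der u 1‖ ≤ K * ‖u‖ := by gcongr; exact norm_der_le u 1
  linarith

theorem exists_mulL2 {m : UnitAddCircle → ℝ} (hm : MemLp m ∞ volume) :
    ∃ Λ : L2 →L[ℝ] L2, ∀ f : L2, ∀ᵐ x, Λ f x = m x • f x := by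
  refine ⟨ContinuousLinearMap.holderL volume ∞ 2 2
    (ContinuousLinearMap.lsmul ℝ ℝ : ℝ →L[ℝ] Plane →L[ℝ] Plane) (hm.toLp m), fun f => ?_⟩
  filter_upwards [hm.coeFn_toLp, ContinuousLinearMap.coeFn_holder (r := 2)
    (ContinuousLinearMap.lsmul ℝ ℝ : ℝ →L[ℝ] Plane →L[ℝ] Plane) (hm.toLp m) f] with x h1 h2
  rw [ContinuousLinearMap.holderL_apply_apply, h2, h1]
  rfl

/-- The derivative of the weight is only in `L²`, so in the product rule the term `m' u` needs the
sup bound on `u ∈ H¹`. -/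
theorem exists_mulH1_L2 {m : UnitAddCircle → ℝ} (hm : MemLp m 2 volume) :
    ∃ Λ : H 1 →L[ℝ] L2, ∀ u : H 1, ∀ᵐ x, Λ u x = m x • der u 0 x := by
  obtain ⟨C, hC, hb⟩ := exists_sup_bound
  have hI : ∀ u : H 1, MemLp (der u 0) ∞ volume := fun u =>
    memLp_top_of_bound (Lp.aestronglyMeasurable _) _ (hb u)
  let ι : H 1 →ₗ[ℝ] Lp Plane ∞ (volume : Measure UnitAddCircle) :=
    { toFun := fun u => (hI u).toLp _
      map_add' := by
        intro u v
        rw [← MemLp.toLp_add]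
        exact MemLp.toLp_congr _ _ (Lp.coeFn_add (der u 0) (der v 0))
      map_smul' := by
        intro a u
        rw [RingHom.id_apply, ← MemLp.toLp_const_smul]
        exact MemLp.toLp_congr _ _ (Lp.coeFn_smul a (der u 0)) }
  let ιL := ι.mkContinuous ((measureUnivNNReal (volume : Measure UnitAddCircle) : ℝ) ^
    (∞ : ℝ≥0∞).toReal⁻¹ * C) fun u => by
      rw [mul_assoc]
      refine Lp.norm_le_of_ae_bound (mul_nonneg hC (norm_nonneg u)) ?_
      filter_upwards [hb u, (hI u).coeFn_toLp] with x h1 h2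
      exact (congrArg norm h2).trans_le h1
  refine ⟨(ContinuousLinearMap.holderL volume 2 ∞ 2
    (ContinuousLinearMap.lsmul ℝ ℝ : ℝ →L[ℝ] Plane →L[ℝ] Plane) (hm.toLp m)).comp ιL, fun u => ?_⟩
  filter_upwards [hm.coeFn_toLp, (hI u).coeFn_toLp, ContinuousLinearMap.coeFn_holder (r := 2)
    (ContinuousLinearMap.lsmul ℝ ℝ : ℝ →L[ℝ] Plane →L[ℝ] Plane) (hm.toLp m) (ιL u)] with x h1 h2 h3
  rw [ContinuousLinearMap.comp_apply, ContinuousLinearMap.holderL_apply_apply, h3, h1]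
  exact congrArg (m x • ·) h2

theorem IsAbsCont.congr {E : Type*} [NormedAddCommGroup E] [NormedSpace ℝ E]
    {f g f' g' : UnitAddCircle → E} (h : IsAbsCont f g) (hf : ∀ᵐ x, f x = f' x)
    (hg : ∀ᵐ x, g x = g' x) : IsAbsCont f' g' := by
  obtain ⟨h1, h2, c, hc⟩ := h
  rw [ae_circle_iff] at hf hg
  have hi : ∀ s ∈ Icc (0 : ℝ) 1, ∫ r in (0 : ℝ)..s, g' r = ∫ r in (0 : ℝ)..s, g r := by
    intro s hs
    rw [intervalIntegral.integral_of_le hs.1, intervalIntegral.integral_of_le hs.1]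
    exact (integral_congr_ae
      (ae_restrict_of_ae_restrict_of_subset (Ioc_subset_Ioc_right hs.2) hg)).symm
  refine ⟨h1.congr_fun_ae hg, by rw [hi 1 (by simp), h2], c, ?_⟩
  filter_upwards [hc, hf, ae_restrict_mem measurableSet_Ioc] with s e1 e2 hs
  rw [hi s (Ioc_subset_Icc_self hs), ← e1, e2]

/-- Multiplication by a scalar `H¹` function is bounded on `H¹`. -/
theorem exists_mulH1 {m m' : UnitAddCircle → ℝ} (hm : MemLp m ∞ volume) (hm' : MemLp m' 2 volume)
    (h : IsAbsCont m m') :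
    ∃ Λ : H 1 →L[ℝ] H 1, ∀ u : H 1, ∀ᵐ x, der (Λ u) 0 x = m x • der u 0 x := by
  obtain ⟨Λ₀, h0⟩ := exists_mulL2 hm
  obtain ⟨Λ₁, h1⟩ := exists_mulH1_L2 hm'
  refine ⟨mkHL ![Λ₀.comp (derL 0), Λ₁ + Λ₀.comp (derL 1)] ?_, fun u => ?_⟩
  · intro u j
    obtain rfl : j = 0 := Subsingleton.elim _ _
    rw [isWeakDeriv_iff]
    refine ((h.bilin (ContinuousLinearMap.lsmul ℝ ℝ : ℝ →L[ℝ] Plane →L[ℝ] Plane)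
      (isAbsCont_H1 u))).congr ?_ ?_
    · filter_upwards [h0 (der u 0)] with x hx using hx.symm
    · filter_upwards [h0 (der u 1), h1 u, Lp.coeFn_add (Λ₁ u) (Λ₀ (der u 1))] with x e1 e2 e3
      exact (e3.trans (by rw [Pi.add_apply, e1, e2]; rfl)).symm
  · exact h0 (der u 0)

/-- `φ e` for a test function `φ` and a vector `e`. -/
theorem exists_testH1 {φ : UnitAddCircle → ℝ} (hφ : IsTest φ) (e : Plane) :
    ∃ u : H 1, (∀ᵐ x, der u 0 x = φ x • e) ∧ ∀ᵐ x, der u 1 x = circDeriv φ x • e := by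
  have m0 : MemLp (fun x => φ x • e) 2 (volume : Measure UnitAddCircle) :=
    (hφ.continuous.smul continuous_const).memLp_of_hasCompactSupport
      (HasCompactSupport.of_compactSpace _)
  have m1 : MemLp (fun x => circDeriv φ x • e) 2 (volume : Measure UnitAddCircle) :=
    (hφ.continuous_circDeriv.smul continuous_const).memLp_of_hasCompactSupport
      (HasCompactSupport.of_compactSpace _)
  refine ⟨⟨WithLp.toLp 2 ![m0.toLp _, m1.toLp _], ?_⟩, m0.coeFn_toLp, m1.coeFn_toLp⟩
  intro j
  obtain rfl : j = 0 := Subsingleton.elim _ _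
  rw [isWeakDeriv_iff]
  refine IsAbsCont.congr (f := fun x => φ x • e) (g := fun x => circDeriv φ x • e) ?_
    (m0.coeFn_toLp.mono fun x hx => hx.symm) (m1.coeFn_toLp.mono fun x hx => hx.symm)
  have hi : ∀ s : ℝ, ∫ r in (0 : ℝ)..s, circDeriv φ (r : UnitAddCircle) • e =
      (φ (s : UnitAddCircle) - φ ((0 : ℝ) : UnitAddCircle)) • e := by
    intro s
    have hd : Continuous (deriv fun r : ℝ => φ (r : UnitAddCircle)) :=
      ContDiff.continuous_deriv hφ (by simp)
    rw [intervalIntegral.integral_smul_const]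
    congr 1
    simp only [circDeriv_coe]
    exact intervalIntegral.integral_deriv_eq_sub
      (fun x _ => (ContDiff.differentiable hφ (by simp)) x) (hd.intervalIntegrable _ _)
  refine ⟨integrableOn_coe_of_memLp m1, ?_, φ ((0 : ℝ) : UnitAddCircle) • e,
    Eventually.of_forall fun s => ?_⟩
  · rw [hi, AddCircle.coe_period, ← AddCircle.coe_zero, sub_self, zero_smul]
  · rw [hi, ← add_smul, add_sub_cancel]

end Sobolev

/-! ### The weight `π|∂ₓη|²` and the elliptic problem in space. -/

section Resolvent

/-- The inverse `π |∂ₓη|²` of the coefficient of `A(η)` is a positive scalar `H¹` function. -/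
theorem exists_weight {η : H 2} (hη : η ∈ V) :
    ∃ m' : UnitAddCircle → ℝ, IsAbsCont (fun x => Real.pi * ‖der η 1 x‖ ^ 2) m' ∧
      MemLp (fun x => Real.pi * ‖der η 1 x‖ ^ 2) ∞ volume ∧ MemLp m' 2 volume ∧
      ∃ c : ℝ, 0 < c ∧ ∀ᵐ x, c ≤ Real.pi * ‖der η 1 x‖ ^ 2 := by
  obtain ⟨κ, hκ, hlow⟩ := exists_lower_bound_of_mem_V hη
  have hac : IsAbsCont (der η 1) (der η 2) := isAbsCont_der η 1
  have hsup := hac.norm_le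
  set N := (∫ x, ‖der η 1 x‖) + 2 * ∫ x, ‖der η 2 x‖ with hN
  have m1 := Lp.aestronglyMeasurable (der η 1)
  have m2 := Lp.aestronglyMeasurable (der η 2)
  set B : Plane →L[ℝ] Plane →L[ℝ] ℝ := Real.pi • (innerSL ℝ : Plane →L[ℝ] Plane →L[ℝ] ℝ) with hB
  have hBx : ∀ v w, B v w = Real.pi * inner ℝ v w := fun v w => rfl
  have hpi := Real.pi_pos
  refine ⟨fun x => B (der η 2 x) (der η 1 x) + B (der η 1 x) (der η 2 x), ?_, ?_, ?_, ?_⟩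
  · refine (hac.bilin B hac).congr (Eventually.of_forall fun x => ?_)
      (Eventually.of_forall fun x => rfl)
    rw [hBx, real_inner_self_eq_norm_sq]
  · refine memLp_top_of_bound ((m1.norm.pow 2).const_mul _) (Real.pi * N ^ 2) ?_
    filter_upwards [hsup] with x hx
    rw [Real.norm_of_nonneg (by positivity)]
    gcongr
  · refine (Lp.memLp (der η 2)).of_le_mul (c := 2 * Real.pi * N)
      ((B.aestronglyMeasurable_comp₂ m2 m1).add (B.aestronglyMeasurable_comp₂ m1 m2)) ?_
    filter_upwards [hsup] with x hx
    rw [hBx, hBx, real_inner_comm, ← two_mul, norm_mul, norm_mul, Real.norm_of_nonneg hpi.le,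
      Real.norm_of_nonneg zero_le_two]
    have h1 : ‖inner ℝ (der η 1 x) (der η 2 x)‖ ≤ N * ‖der η 2 x‖ :=
      (norm_inner_le_norm _ _).trans (by gcongr)
    calc 2 * (Real.pi * ‖inner ℝ (der η 1 x) (der η 2 x)‖)
        ≤ 2 * (Real.pi * (N * ‖der η 2 x‖)) := by gcongr
      _ = 2 * Real.pi * N * ‖der η 2 x‖ := by ring
  · refine ⟨Real.pi * κ ^ 2, by positivity, ?_⟩
    filter_upwards [hlow] with x hx
    gcongr

set_option maxHeartbeats 1000000 in
/-- The resolvent `(1 - m⁻¹ ∂ₓ²)⁻¹` on `H¹`, obtained from the forms `∫ m u·φ` and `∫ ∂ₓu·∂ₓφ`, and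
its regularization to `H³`. -/
theorem exists_spatial_resolvent {m m' : UnitAddCircle → ℝ} (hac : IsAbsCont m m')
    (hm : MemLp m ∞ volume) (hm' : MemLp m' 2 volume) {c : ℝ} (hc : 0 < c)
    (hcm : ∀ᵐ x, c ≤ m x) :
    ∃ (M D R : H 1 →L[ℝ] H 1) (R₃ : H 1 →L[ℝ] H 3) (κ : ℝ), 0 < κ ∧
      (∀ x y, inner ℝ (M x) y = inner ℝ (M y) x) ∧ (∀ x y, inner ℝ (D x) y = inner ℝ (D y) x) ∧
      (∀ x, 0 ≤ inner ℝ (M x) x) ∧ (∀ x, 0 ≤ inner ℝ (D x) x) ∧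
      (∀ x, inner ℝ (M x) x = 0 → x = 0) ∧ (∀ x, κ * ‖x‖ ^ 2 ≤ inner ℝ (M x + D x) x) ∧
      (∀ x, M (R x) + D (R x) = M x) ∧ (∀ f, toL2 (R₃ f) = toL2 (R f)) ∧
      (∀ f, ∀ᵐ x, der (R₃ f) 2 x = m x • (toL2 (R f) x - toL2 f x)) ∧
      ∀ (u f : H 1) (v : H 3), toL2 v = toL2 u →
        (∀ᵐ x, der v 2 x = m x • (toL2 u x - toL2 f x)) → u = R f := by
  obtain ⟨Λ, hΛ⟩ := exists_mulL2 hm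
  obtain ⟨Q, hQ⟩ := exists_mulH1 hm hm' hac
  -- Adjoints into `H¹` represent the two forms as bounded operators on `H¹`, so no unbounded
  -- operator appears.
  set M : H 1 →L[ℝ] H 1 := (ContinuousLinearMap.adjoint (derL 0)).comp (Λ.comp (derL 0)) with hMdef
  set D : H 1 →L[ℝ] H 1 := (ContinuousLinearMap.adjoint (derL 1)).comp (derL 1) with hDdef
  have hMx : ∀ x y : H 1, inner ℝ (M x) y = inner ℝ (Λ (der x 0)) (der y 0) := fun x y => by
    simp only [hMdef, ContinuousLinearMap.comp_apply, ContinuousLinearMap.adjoint_inner_left,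
      derL_apply]
  have hDx : ∀ x y : H 1, inner ℝ (D x) y = inner ℝ (der x 1) (der y 1) := fun x y => by
    simp only [hDdef, ContinuousLinearMap.comp_apply, ContinuousLinearMap.adjoint_inner_left,
      derL_apply]
  have hMi : ∀ x y : H 1, inner ℝ (M x) y = ∫ s, m s * inner ℝ (der x 0 s) (der y 0 s) := by
    intro x y
    rw [hMx, L2.inner_def]
    refine integral_congr_ae ?_
    filter_upwards [hΛ (der x 0)] with s hs
    rw [hs, real_inner_smul_left]
  have hMs : ∀ x y, inner ℝ (M x) y = inner ℝ (M y) x := by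
    intro x y
    rw [hMi, hMi]
    simp only [real_inner_comm]
  have hDs : ∀ x y, inner ℝ (D x) y = inner ℝ (D y) x := fun x y => by
    rw [hDx, hDx, real_inner_comm]
  have hMc : ∀ x : H 1, c * ‖der x 0‖ ^ 2 ≤ inner ℝ (M x) x := by
    intro x
    rw [hMx, ← real_inner_self_eq_norm_sq, L2.inner_def, L2.inner_def, ← integral_const_mul]
    refine integral_mono_ae ((L2.integrable_inner _ _).const_mul c) (L2.integrable_inner _ _) ?_
    filter_upwards [hcm, hΛ (der x 0)] with s h1 h2
    rw [h2, real_inner_smul_left]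
    gcongr
    exact real_inner_self_nonneg
  have hD1 : ∀ x : H 1, inner ℝ (D x) x = ‖der x 1‖ ^ 2 := fun x => by
    rw [hDx, real_inner_self_eq_norm_sq]
  have hcoer : ∀ x : H 1, min c 1 * ‖x‖ ^ 2 ≤ inner ℝ (M x + D x) x := by
    intro x
    rw [inner_add_left, hD1, norm_sq_H1]
    have h1 := hMc x
    have h2 : min c 1 * ‖der x 0‖ ^ 2 ≤ c * ‖der x 0‖ ^ 2 := by gcongr; exact min_le_left _ _
    have h3 : min c 1 * ‖der x 1‖ ^ 2 ≤ 1 * ‖der x 1‖ ^ 2 := by gcongr; exact min_le_right _ _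
    linarith
  have hκ : 0 < min c 1 := lt_min hc one_pos
  obtain ⟨R, hR⟩ := exists_resolvent M D hκ hcoer
  have huniq : ∀ u f : H 1, M u + D u = M f → u = R f := by
    intro u f h
    have h1 := hcoer (u - R f)
    have h2 : M (u - R f) + D (u - R f) = 0 := by
      rw [map_sub, map_sub]
      calc M u - M (R f) + (D u - D (R f)) = (M u + D u) - (M (R f) + D (R f)) := by abel
        _ = 0 := by rw [h, hR, sub_self]
    rw [h2, inner_zero_left] at h1
    have h3 : ‖u - R f‖ ^ 2 ≤ 0 := by
      by_contra h4
      have := mul_pos hκ (not_le.1 h4)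
      linarith
    exact sub_eq_zero.1 (norm_eq_zero.1 (pow_eq_zero_iff two_ne_zero |>.1
      (le_antisymm h3 (sq_nonneg _))))
  -- The weak equation reads `D (R f) = -M (R f - f)`. Pairing it with `φ e` for each fixed vector
  -- `e` gives `∂ₓ²(R f) = m (R f - f)`.
  have hweak : ∀ f : H 1, IsWeakDeriv (der (R f) 1) (der (Q (R f - f)) 0) := by
    intro f φ hφ
    refine ext_inner_right ℝ fun e => ?_
    obtain ⟨u, hu0, hu1⟩ := exists_testH1 hφ e
    have h1 : inner ℝ (M (R f)) u + inner ℝ (D (R f)) u = inner ℝ (M f) u := by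
      rw [← inner_add_left, hR]
    have h2 : inner ℝ (D (R f)) u = -inner ℝ (M (R f - f)) u := by
      rw [map_sub, inner_sub_left]; linarith
    have hI : ∀ (ψ : UnitAddCircle → ℝ), Continuous ψ → ∀ g : L2,
        Integrable (fun x => ψ x • g x) volume := fun ψ hψ g =>
      ((Lp.memLp g).smul (memLp_circle hψ) (p := 2) (q := 2) (r := 1)).integrable le_rfl
    have e1 : inner ℝ (D (R f)) u = inner ℝ (∫ x, circDeriv φ x • der (R f) 1 x) e := by
      rw [hDx, L2.inner_def, real_inner_comm,
        ← integral_inner (hI _ hφ.continuous_circDeriv _) e]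
      refine integral_congr_ae ?_
      filter_upwards [hu1] with x hx
      rw [hx, real_inner_smul_right, real_inner_smul_right, real_inner_comm]
    have e2 : inner ℝ (M (R f - f)) u = inner ℝ (∫ x, φ x • der (Q (R f - f)) 0 x) e := by
      rw [hMi, real_inner_comm, ← integral_inner (hI _ hφ.continuous _) e]
      refine integral_congr_ae ?_
      filter_upwards [hu0, hQ (R f - f)] with x hx h3
      rw [hx, h3, real_inner_smul_right, real_inner_smul_right, real_inner_smul_right,
        real_inner_comm]
      ring
    rw [← e1, inner_neg_left, ← e2, h2]
  -- `W f = m (R f - f)` is the second derivative of `R f`; it lies in `H¹`, so its own derivative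
  -- serves as the third.
  set W : H 1 →L[ℝ] H 1 := Q.comp (R - ContinuousLinearMap.id ℝ (H 1)) with hW
  have hWx : ∀ f, W f = Q (R f - f) := fun f => rfl
  refine ⟨M, D, R, mkHL ![(derL 0).comp R, (derL 1).comp R, (derL 0).comp W, (derL 1).comp W] ?_,
    min c 1, hκ, hMs, hDs, fun x => le_trans (by positivity) (hMc x),
    fun x => by rw [hD1]; positivity, ?_, hcoer, hR, fun f => rfl, ?_, ?_⟩
  · intro f j
    fin_cases j
    · exact (R f).2 0
    · exact hweak f
    · exact (W f).2 0
  · intro x hx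
    have h1 := hMc x
    rw [hx] at h1
    have h3 : ‖der x 0‖ ^ 2 ≤ 0 := by
      by_contra h4
      have := mul_pos hc (not_le.1 h4)
      linarith
    have h4 : der x 0 = 0 := norm_eq_zero.1 (pow_eq_zero_iff two_ne_zero |>.1
      (le_antisymm h3 (sq_nonneg _)))
    exact toL2_injective 1 (h4.trans (by simp [toL2, der]))
  · intro f
    have h1 := Lp.coeFn_sub (der (R f) 0) (der f 0)
    filter_upwards [hQ (R f - f), h1] with x h2 h3
    exact h2.trans (congrArg (m x • ·) h3)
  · intro u f v huv hv
    refine huniq u f (ext_inner_right ℝ fun φ => ?_)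
    have hd : der v 1 = der u 1 := der_succ_eq_of_der_castSucc_eq (i := 0) (j := 0) huv
    have h1 : IsAbsCont (der v 1) (der v 2) := isAbsCont_der v 1
    have h2 := h1.integral_parts (innerSL ℝ : Plane →L[ℝ] Plane →L[ℝ] ℝ) (isAbsCont_H1 φ)
    have h3 : inner ℝ (der v 2) (der φ 0) + inner ℝ (der v 1) (der φ 1) = (0 : ℝ) := by
      rw [L2.inner_def, L2.inner_def, ← integral_add (L2.integrable_inner _ _)
        (L2.integrable_inner _ _)]
      exact h2
    have h4 : inner ℝ (der v 2) (der φ 0) = inner ℝ (M (u - f)) φ := by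
      rw [hMi, L2.inner_def]
      refine integral_congr_ae ?_
      filter_upwards [hv, Lp.coeFn_sub (der u 0) (der f 0)] with x h5 h6
      rw [h5, real_inner_smul_left]
      exact congrArg (fun z => m x * inner ℝ z (der φ 0 x)) h6.symm
    rw [h4, hd, ← hDx, map_sub, inner_sub_left] at h3
    rw [inner_add_left]
    linarith

end Resolvent

/-! ### From the integrated equation back to solutions in `E T`. -/

section MaximalRegularity

/-- Multiplying the equation by `m = π|∂ₓη|²` gives `∂ₓ²γ = m (γ - f)` with `f = γ + g - ∂ₜγ`, which
says `γ = R f`; the initial condition is absorbed into `γ = J ∂ₜγ`. -/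
theorem isSolution_iff {T : ℝ} (hT : 0 < T) {η : H 2} {R : H 1 →L[ℝ] H 1} {R₃ : H 1 →L[ℝ] H 3}
    {c : ℝ} (hc : 0 < c) (hcm : ∀ᵐ x, c ≤ Real.pi * ‖der η 1 x‖ ^ 2)
    (hR₃ : ∀ f, toL2 (R₃ f) = toL2 (R f))
    (hR₃' : ∀ f, ∀ᵐ x,
      der (R₃ f) 2 x = (Real.pi * ‖der η 1 x‖ ^ 2) • (toL2 (R f) x - toL2 f x))
    (hR : ∀ (u f : H 1) (v : H 3), toL2 v = toL2 u →
      (∀ᵐ x, der v 2 x = (Real.pi * ‖der η 1 x‖ ^ 2) • (toL2 u x - toL2 f x)) → u = R f)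
    (g : TimeL2 T (H 1)) (γ : E T) :
    IsSolution η g γ ↔ inH1 γ = timePrimitive (H 1) hT (dt γ) ∧
      inH1 γ = R.compLpL 2 (timeMeasure T) (inH1 γ + g - dt γ) ∧
      inH3 γ = R₃.compLpL 2 (timeMeasure T) (inH1 γ + g - dt γ) := by
  have hγ : ∀ᵐ t ∂timeMeasure T, toL2 (inH1 γ t) = toL2 (inH3 γ t) := γ.2
  have hcomb : ∀ᵐ t ∂timeMeasure T, (inH1 γ + g - dt γ : TimeL2 T (H 1)) t =
      inH1 γ t + g t - dt γ t := by
    filter_upwards [Lp.coeFn_sub (inH1 γ + g) (dt γ), Lp.coeFn_add (inH1 γ) g] with t h1 h2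
    rw [h1, Pi.sub_apply, h2, Pi.add_apply]
  have hL2 : ∀ a b d : H 1, ∀ᵐ x, toL2 (a + b - d) x = toL2 a x + toL2 b x - toL2 d x := by
    intro a b d
    filter_upwards [Lp.coeFn_sub (toL2 a + toL2 b) (toL2 d),
      Lp.coeFn_add (toL2 a) (toL2 b)] with x h1 h2
    exact h1.trans (by rw [Pi.sub_apply, h2, Pi.add_apply])
  constructor
  · rintro ⟨heq, w, hw, hwu, hw0⟩
    have h1 : inH1 γ = R.compLpL 2 (timeMeasure T) (inH1 γ + g - dt γ) := by
      refine Lp.ext ?_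
      filter_upwards [heq, hγ, hcomb,
        R.coeFn_compLpL (p := 2) (μ := timeMeasure T) (inH1 γ + g - dt γ)] with t h1 h2 h3 h4
      rw [h4, h3]
      refine hR _ _ (inH3 γ t) h2.symm ?_
      filter_upwards [h1, hcm, hL2 (inH1 γ t) (g t) (dt γ t)] with x e1 e2 e3
      have hne : Real.pi * ‖der η 1 x‖ ^ 2 ≠ 0 := (hc.trans_le e2).ne'
      have h5 : toL2 (inH1 γ t) x - (toL2 (inH1 γ t) x + toL2 (g t) x - toL2 (dt γ t) x) =
          A η (inH3 γ t) x := by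
        rw [e1]; abel
      rw [e3, h5, A, smul_smul, mul_inv_cancel₀ hne, one_smul]
    refine ⟨eq_timePrimitive_of_mem_timeH1 hT γ.1.fst.2 hw hwu hw0, h1, ?_⟩
    refine Lp.ext ?_
    filter_upwards [hγ, R₃.coeFn_compLpL (p := 2) (μ := timeMeasure T) (inH1 γ + g - dt γ),
      R.coeFn_compLpL (p := 2) (μ := timeMeasure T) (inH1 γ + g - dt γ)] with t h2 h3 h4
    refine toL2_injective 3 ?_
    rw [h3, hR₃, ← h4, ← h1, h2]
  · rintro ⟨h1, h2, h3⟩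
    refine ⟨?_, fun t => ∫ r in 0..t, dt γ r,
      continuousOn_primitive hT.le (integrableOn_timeL2 _), ?_, by simp⟩
    · have e2 := R.coeFn_compLpL (p := 2) (μ := timeMeasure T) (inH1 γ + g - dt γ)
      have e3 := R₃.coeFn_compLpL (p := 2) (μ := timeMeasure T) (inH1 γ + g - dt γ)
      rw [← h2] at e2
      rw [← h3] at e3
      filter_upwards [e2, e3, hcomb] with t e2 e3 e4
      rw [e4] at e2 e3
      filter_upwards [hR₃' (inH1 γ t + g t - dt γ t), hcm,
        hL2 (inH1 γ t) (g t) (dt γ t)] with x e5 e6 e7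
      have hne : Real.pi * ‖der η 1 x‖ ^ 2 ≠ 0 := (hc.trans_le e6).ne'
      rw [← e2, ← e3, e7] at e5
      rw [A, e5, smul_smul, inv_mul_cancel₀ hne, one_smul]
      abel
    · have := timePrimitive_ae hT (dt γ)
      rw [← h1] at this
      filter_upwards [this] with t ht using ht.symm

theorem norm_E_le {T : ℝ} (γ : E T) : ‖γ‖ ≤ ‖inH1 γ‖ + ‖dt γ‖ + ‖inH3 γ‖ := by
  have h1 : ‖γ‖ ^ 2 = ‖γ.1.fst‖ ^ 2 + ‖inH3 γ‖ ^ 2 := WithLp.prod_norm_sq_eq_of_L2 γ.1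
  have h2 : ‖γ.1.fst‖ ^ 2 = ‖inH1 γ‖ ^ 2 + ‖dt γ‖ ^ 2 :=
    WithLp.prod_norm_sq_eq_of_L2 γ.1.fst.1
  refine abs_le_of_sq_le_sq' ?_ (by positivity) |>.2
  nlinarith [norm_nonneg (inH1 γ), norm_nonneg (dt γ), norm_nonneg (inH3 γ),
    mul_nonneg (norm_nonneg (inH1 γ)) (norm_nonneg (dt γ)),
    mul_nonneg (norm_nonneg (inH1 γ)) (norm_nonneg (inH3 γ)),
    mul_nonneg (norm_nonneg (dt γ)) (norm_nonneg (inH3 γ))]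

theorem E_ext {T : ℝ} {γ γ' : E T} (h1 : inH1 γ = inH1 γ') (h2 : dt γ = dt γ')
    (h3 : inH3 γ = inH3 γ') : γ = γ' := by
  refine Subtype.ext (WithLp.ofLp_injective 2 (Prod.ext (Subtype.ext ?_) h3))
  exact WithLp.ofLp_injective 2 (Prod.ext h1 h2)

theorem exists_E {T : ℝ} {u p : TimeL2 T (H 1)} (v : TimeL2 T (H 3))
    (h : WithLp.toLp 2 (u, p) ∈ TimeH1 T (H 1))
    (huv : ∀ᵐ t ∂timeMeasure T, toL2 (u t) = toL2 (v t)) :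
    ∃ γ : E T, inH1 γ = u ∧ dt γ = p ∧ inH3 γ = v := by
  let w : TimeH1 T (H 1) := ⟨WithLp.toLp 2 (u, p), h⟩
  exact ⟨⟨WithLp.toLp 2 (w, v), huv⟩, rfl, rfl, rfl⟩

/-- Transfer of well-posedness from the integrated equation `J p = R (J p + g - p)` to solutions `z`
that are recorded by a function `u z`, its derivative `d z` and a more regular version `v z`. -/
theorem wellPosed_of_iff {Y W Z : Type*} [NormedAddCommGroup Y] [NormedSpace ℝ Y]
    [NormedAddCommGroup W] [NormedSpace ℝ W] (J R : Y →L[ℝ] Y) (S : Y →L[ℝ] W)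
    (hJR : (∀ g, ∃! p, J p = R (J p + g - p)) ∧
      ∃ K : ℝ, 0 < K ∧ ∀ g p, J p = R (J p + g - p) → ‖p‖ ≤ K * ‖g‖)
    (u d : Z → Y) (v : Z → W) (ν : Z → ℝ) (IsSol : Y → Z → Prop)
    (hext : ∀ z z', u z = u z' → d z = d z' → v z = v z' → z = z')
    (hmk : ∀ p f, J p = R f → ∃ z, u z = J p ∧ d z = p ∧ v z = S f)
    (hν : ∀ z, ν z ≤ ‖u z‖ + ‖d z‖ + ‖v z‖)
    (hiff : ∀ g z, IsSol g z ↔ u z = J (d z) ∧ u z = R (u z + g - d z) ∧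
      v z = S (u z + g - d z)) :
    (∀ g, ∃! z, IsSol g z) ∧ ∃ C : ℝ, 0 < C ∧ ∀ g z, IsSol g z → ν z ≤ C * ‖g‖ := by
  obtain ⟨hex, K, hK, hbound⟩ := hJR
  refine ⟨fun g => ?_, ?_⟩
  · obtain ⟨p, hp, hpu⟩ := hex g
    obtain ⟨z, e1, e2, e3⟩ := hmk p _ hp
    refine ⟨z, (hiff g z).2 ⟨by rw [e1, e2], by rw [e1, e2, ← hp], by rw [e1, e2, e3]⟩,
      fun z' hz' => ?_⟩
    obtain ⟨h1, h2, h3⟩ := (hiff g z').1 hz'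
    have hd : d z' = p := hpu _ (by rw [h1] at h2; exact h2)
    have h4 : u z' = J p := by rw [h1, hd]
    exact hext _ _ (h4.trans e1.symm) (hd.trans e2.symm) (by rw [h3, h4, hd, e3])
  -- The summands bound `u z = J (d z)`, `d z`, and `v z = S (u z + g - d z)` in turn.
  · refine ⟨‖J‖ * K + K + ‖S‖ * (‖J‖ * K + 1 + K), by positivity, fun g z hz => ?_⟩
    obtain ⟨h1, h2, h3⟩ := (hiff g z).1 hz
    have hd : ‖d z‖ ≤ K * ‖g‖ := hbound g (d z) (by rw [h1] at h2; exact h2)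
    have hu : ‖u z‖ ≤ ‖J‖ * K * ‖g‖ := by
      rw [h1, mul_assoc]
      exact (J.le_opNorm _).trans (by gcongr)
    have hv : ‖v z‖ ≤ ‖S‖ * (‖J‖ * K * ‖g‖ + ‖g‖ + K * ‖g‖) := by
      rw [h3]
      refine (S.le_opNorm _).trans ?_
      gcongr
      refine (norm_sub_le _ _).trans ?_
      gcongr
      refine (norm_add_le _ _).trans ?_
      gcongr
    refine (hν z).trans ?_
    calc ‖u z‖ + ‖d z‖ + ‖v z‖
        ≤ ‖J‖ * K * ‖g‖ + K * ‖g‖ + ‖S‖ * (‖J‖ * K * ‖g‖ + ‖g‖ + K * ‖g‖) := by gcongr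
      _ = _ := by ring

theorem exists_E_of_resolvent {T : ℝ} (hT : 0 < T) {R : H 1 →L[ℝ] H 1} {R₃ : H 1 →L[ℝ] H 3}
    (hR₃ : ∀ f, toL2 (R₃ f) = toL2 (R f)) (p f : TimeL2 T (H 1))
    (hp : timePrimitive (H 1) hT p = R.compLpL 2 (timeMeasure T) f) :
    ∃ γ : E T, inH1 γ = timePrimitive (H 1) hT p ∧ dt γ = p ∧
      inH3 γ = R₃.compLpL 2 (timeMeasure T) f := by
  refine exists_E (R₃.compLpL 2 (timeMeasure T) f) (mem_timeH1_timePrimitive hT p) ?_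
  filter_upwards [R.coeFn_compLpL (p := 2) (μ := timeMeasure T) f,
    R₃.coeFn_compLpL (p := 2) (μ := timeMeasure T) f] with t h1 h2
  rw [h2, hR₃, ← h1, ← hp]

theorem exists_evolution_resolvent {η : H 2} (hη : η ∈ V) {T : ℝ} (hT : 0 < T) :
    ∃ (R : H 1 →L[ℝ] H 1) (R₃ : H 1 →L[ℝ] H 3) (c : ℝ),
      (0 < c ∧ (∀ᵐ x, c ≤ Real.pi * ‖der η 1 x‖ ^ 2)) ∧ (∀ f, toL2 (R₃ f) = toL2 (R f)) ∧
      (∀ f, ∀ᵐ x,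
        der (R₃ f) 2 x = (Real.pi * ‖der η 1 x‖ ^ 2) • (toL2 (R f) x - toL2 f x)) ∧
      (∀ (u f : H 1) (v : H 3), toL2 v = toL2 u →
        (∀ᵐ x, der v 2 x = (Real.pi * ‖der η 1 x‖ ^ 2) • (toL2 u x - toL2 f x)) → u = R f) ∧
      (∀ g : TimeL2 T (H 1), ∃! p : TimeL2 T (H 1), timePrimitive (H 1) hT p =
        R.compLpL 2 (timeMeasure T) (timePrimitive (H 1) hT p + g - p)) ∧
      ∃ C : ℝ, 0 < C ∧ ∀ g p : TimeL2 T (H 1), timePrimitive (H 1) hT p =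
        R.compLpL 2 (timeMeasure T) (timePrimitive (H 1) hT p + g - p) → ‖p‖ ≤ C * ‖g‖ := by
  obtain ⟨m', hac, hm, hm', c, hc, hcm⟩ := exists_weight hη
  obtain ⟨M, D, R, R₃, κ, hκ, hMs, hDs, hM0, hD0, hMinj, hcoer, hR, hR₃, hR₃', hRu⟩ :=
    exists_spatial_resolvent hac hm hm' hc hcm
  exact ⟨R, R₃, c, ⟨hc, hcm⟩, hR₃, hR₃', hRu,
    existsUnique_evolution hT M D R hκ hMs hDs hM0 hD0 hMinj hcoer hR⟩

theorem maximal_regularity (η : H 2) (hη : η ∈ V) (T : ℝ) (hT : 0 < T) :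
    (∀ g : TimeL2 T (H 1), ∃! γ : E T, IsSolution η g γ) ∧
    ∃ C : ℝ, 0 < C ∧ ∀ (g : TimeL2 T (H 1)) (γ : E T),
      IsSolution η g γ → ‖γ‖ ≤ C * ‖g‖ := by
  refine (exists_evolution_resolvent hη hT).elim fun R h => h.elim fun R₃ h => h.elim fun c h => ?_
  exact wellPosed_of_iff (timePrimitive (H 1) hT) (R.compLpL 2 (timeMeasure T))
    (R₃.compLpL 2 (timeMeasure T)) h.2.2.2.2 inH1 dt inH3 (fun γ => ‖γ‖) (IsSolution η)
    (fun _ _ => E_ext) (exists_E_of_resolvent hT h.2.1) norm_E_le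
    (isSolution_iff hT h.1.1 h.1.2 h.2.1 h.2.2.1 h.2.2.2.1)

end MaximalRegularity

end

end ILLSS

theorem proposition4p13 (η : ILLSS.H 2) (hη : η ∈ ILLSS.V) (T : ℝ) (hT : 0 < T) :
    (∀ g : ILLSS.TimeL2 T (ILLSS.H 1), ∃! γ : ILLSS.E T, ILLSS.IsSolution η g γ) ∧
    ∃ C : ℝ, 0 < C ∧ ∀ (g : ILLSS.TimeL2 T (ILLSS.H 1)) (γ : ILLSS.E T),
      ILLSS.IsSolution η g γ → ‖γ‖ ≤ C * ‖g‖ :=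
  ILLSS.maximal_regularity η hη T hT
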